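/- Let $p,q$ be coprime positive integers with $\frac12<\frac pq<\frac{\sqrt2}{2}$, and let $a\in(0,\frac\pi4)$ satisfy $\Omega(a)=\frac pq\pi$, where $$\Omega(a)=\sin a\cos a\int_a^{\pi/2-a}\frac{d\nu}{\cos\nu\sqrt{\sin^2\nu\cos^2\nu-\sin^2a\cos^2a}}.$$ Let $(\nu(s),\lambda(s))$, $s\in\mathbb R$, $0<\nu<\frac\pi2$, be a unit speed geodesic of the metric $4\pi^2\sin^2\nu\,(d\nu^2+\cos^2\nu\,d\lambda^2)$ with $\min\nu=\nu(0)=a$, so that $$I(\alpha,s)=(\cos\alpha\sin\nu,\ \sin\alpha\sin\nu,\ \cos\nu\cos\lambda,\ \cos\nu\sin\lambda)\in\mathbb S^3$$ parametrizes the Otsuki torus $O_{p/q}$, and let $I^*$ be a continuous unit normal field of this surface in $\mathbb S^3$. The bipolar surface $\tilde O_{p/q}$ is the image of $I\wedge I^*$; it lies in the unit sphere $\mathbb S^4$ of the hyperplane $\mathbb R^5\subset\Lambda^2\mathbb R^4$ on which the $e_1\wedge e_2$-coordinate vanishes, and $x,y,z,u,v$ denote the coordinates along $e_1\wedge e_3$,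 $e_2\wedge e_3$, $e_1\wedge e_4$, $e_2\wedge e_4$, $e_3\wedge e_4$. Let $(\varphi(t),\theta(t))$, $t\in\mathbb R$, $-\frac\pi2<\varphi<\frac\pi2$, be a unit speed geodesic of the metric $4\pi^2\cos^2\varphi\,(d\varphi^2+\cos^2\varphi\,d\theta^2)$ with $\min\varphi=\varphi(0)=b$ such that $$J_b(\alpha,t)=(x,y,z,u,v)=(\cos\alpha\cos\varphi\sin\theta,\ \sin\alpha\cos\varphi\sin\theta,\ \cos\alpha\cos\varphi\cos\theta,\ \sin\alpha\cos\varphi\cos\theta,\ \sin\varphi)$$ has image $\tilde O_{p/q}$. Then $\Omega(a)=\Xi(b)$, where $$\Xi(b)=\cos^2b\int_b^{-b}\frac{d\varphi}{\cos\varphi\sqrt{\cos^4\varphi-\cos^4b}},$$ and the curve $(\cos\varphi\sin\theta,\cos\varphi\cos\theta,\sin\varphi)$ on the sphere $\mathbb S^2$ is closed. Let $t_0$ be its length, i.e. its least positive period; $J_b$ is then a map on the torus $\mathbb R/2\pi\mathbb Z\times\mathbb R/t_0\mathbb Z$. 1. The function $\sin\varphi(t)$ has exactly $2q$ zeroes on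 $[0,t_0)$, and the functions $\cos\theta(t)$ and $\sin\theta(t)$ have exactly $2p$ zeroes each on $[0,t_0)$. 2. If $q$ is even, then $J_b$ is invariant under the transformation $(\alpha,t)\mapsto(\alpha+\pi,\,t+\frac{t_0}2)$. 3. $J_b$ is not invariant under any other transformation: if $F$ is a continuous map of the torus $\mathbb R/2\pi\mathbb Z\times\mathbb R/t_0\mathbb Z$ to itself with $J_b\circ F=J_b$, then either $F$ is the identity, or $q$ is even and $F$ is the transformation of part 2. -/

import Mathlib

open Real Set

/-- A curve `t ↦ (x t, y t)`, defined for all times, is a unit speed geodesic of the Riemannian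
metric `E(x) dx² + G(x) dy²`. The last two fields are the geodesic equations
`x'' + Γ^x_xx x'² + Γ^x_yy y'² = 0` and `y'' + 2 Γ^y_xy x' y' = 0`, multiplied by the positive
coefficients `E` and `G`. -/
structure IsUnitSpeedGeodesic (E G x y : ℝ → ℝ) : Prop where
  contDiff_fst : ContDiff ℝ 2 x
  contDiff_snd : ContDiff ℝ 2 y
  unit_speed : ∀ t, E (x t) * deriv x t ^ 2 + G (x t) * deriv y t ^ 2 = 1
  geodesic_fst : ∀ t, E (x t) * deriv (deriv x) t + deriv E (x t) / 2 * deriv x t ^ 2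
    - deriv G (x t) / 2 * deriv y t ^ 2 = 0
  geodesic_snd : ∀ t, G (x t) * deriv (deriv y) t + deriv G (x t) * deriv x t * deriv y t = 0

/-- `(ν, lam)` is a unit speed geodesic of the metric `4π² sin² ν (dν² + cos² ν dλ²)` on the open
half-sphere (coordinates `0 < ν < π/2`, longitude `λ`), whose `ν`-coordinate is minimal at time
`0`, with minimal value `a`. -/
structure IsOtsukiGeodesic (a : ℝ) (ν lam : ℝ → ℝ) : Prop where
  mem_Ioo : ∀ t, ν t ∈ Ioo 0 (π / 2)
  geodesic : IsUnitSpeedGeodesic (fun s => (2 * π * sin s) ^ 2)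
    (fun s => (2 * π * sin s) ^ 2 * cos s ^ 2) ν lam
  apply_zero : ν 0 = a
  min_le : ∀ t, a ≤ ν t

/-- The difference of longitudes between a minimum `ν = a` and the next maximum `ν = π/2 - a`
along a geodesic with minimal value `a`. -/
noncomputable def Omega (a : ℝ) : ℝ :=
  sin a * cos a *
    ∫ s in a..(π / 2 - a), 1 / (cos s * √(sin s ^ 2 * cos s ^ 2 - sin a ^ 2 * cos a ^ 2))

/-- The rotation surface in `S³ ⊂ ℝ⁴` over the curve `(ν, lam)`. -/
noncomputable def otsukiImmersion (ν lam : ℝ → ℝ) (α t : ℝ) : EuclideanSpace ℝ (Fin 4) :=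
  !₂[cos α * sin (ν t), sin α * sin (ν t), cos (ν t) * cos (lam t), cos (ν t) * sin (lam t)]

/-- `N` is a continuous field of unit vectors along the surface `I` in `S³`, tangent to `S³` and
normal to the surface. -/
structure IsUnitNormalField (I N : ℝ → ℝ → EuclideanSpace ℝ (Fin 4)) : Prop where
  continuous : Continuous fun x : ℝ × ℝ => N x.1 x.2
  norm_eq_one : ∀ α t, ‖N α t‖ = 1
  tangent_sphere : ∀ α t, inner ℝ (I α t) (N α t) = 0
  normal_fst : ∀ α t, inner ℝ (deriv (fun β => I β t) α) (N α t) = 0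
  normal_snd : ∀ α t, inner ℝ (deriv (fun s => I α s) t) (N α t) = 0

/-- The exterior product `v ∧ w` of two vectors of `ℝ⁴`, in the basis
`e₁∧e₂, e₁∧e₃, e₁∧e₄, e₂∧e₃, e₂∧e₄, e₃∧e₄` of `Λ²ℝ⁴ = ℝ⁶`. -/
noncomputable def wedge (v w : EuclideanSpace ℝ (Fin 4)) : EuclideanSpace ℝ (Fin 6) :=
  !₂[v 0 * w 1 - v 1 * w 0, v 0 * w 2 - v 2 * w 0, v 0 * w 3 - v 3 * w 0,
    v 1 * w 2 - v 2 * w 1, v 1 * w 3 - v 3 * w 1, v 2 * w 3 - v 3 * w 2]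

/-- The surface bipolar to the surface `I` with unit normal field `N`. -/
def bipolarSurface (I N : ℝ → ℝ → EuclideanSpace ℝ (Fin 4)) : Set (EuclideanSpace ℝ (Fin 6)) :=
  range fun x : ℝ × ℝ => wedge (I x.1 x.2) (N x.1 x.2)

/-- The inclusion of `ℝ⁵`, with coordinates `(x, y, z, u, v)`, in `Λ²ℝ⁴ = ℝ⁶` as the hyperplane on
which the coordinate of `e₁∧e₂` vanishes: `x, z, y, u, v` are the coordinates of
`e₁∧e₃, e₁∧e₄, e₂∧e₃, e₂∧e₄, e₃∧e₄`. -/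
noncomputable def equatorInclusion (w : EuclideanSpace ℝ (Fin 5)) : EuclideanSpace ℝ (Fin 6) :=
  !₂[0, w 0, w 2, w 1, w 3, w 4]

/-- `(φ, θ)` is a unit speed geodesic of the metric `4π² cos² φ (dφ² + cos² φ dθ²)` on the sphere
without its poles (`-π/2 < φ < π/2`, longitude `θ`), whose `φ`-coordinate is minimal at time `0`,
with minimal value `b`. -/
structure IsBipolarGeodesic (b : ℝ) (φ θ : ℝ → ℝ) : Prop where
  mem_Ioo : ∀ t, φ t ∈ Ioo (-(π / 2)) (π / 2)
  geodesic : IsUnitSpeedGeodesic (fun s => (2 * π * cos s) ^ 2)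
    (fun s => (2 * π * cos s) ^ 2 * cos s ^ 2) φ θ
  apply_zero : φ 0 = b
  min_le : ∀ t, b ≤ φ t

/-- The difference of longitudes between a minimum `φ = b` and the next maximum `φ = -b`
along a geodesic with minimal value `b`. -/
noncomputable def Xi (b : ℝ) : ℝ :=
  cos b ^ 2 * ∫ s in b..(-b), 1 / (cos s * √(cos s ^ 4 - cos b ^ 4))

/-- The curve on the unit sphere `S² ⊂ ℝ³` with spherical coordinates `(φ, θ)`. -/
noncomputable def sphereCurve (φ θ : ℝ → ℝ) (t : ℝ) : EuclideanSpace ℝ (Fin 3) :=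
  !₂[cos (φ t) * sin (θ t), cos (φ t) * cos (θ t), sin (φ t)]

/-- The immersion `(α, t) ↦ (x, y, z, u, v)` into `S⁴ ⊂ ℝ⁵` associated with the curve `(φ, θ)`. -/
noncomputable def bipolarImmersion (φ θ : ℝ → ℝ) (α t : ℝ) : EuclideanSpace ℝ (Fin 5) :=
  !₂[cos α * cos (φ t) * sin (θ t), sin α * cos (φ t) * sin (θ t),
    cos α * cos (φ t) * cos (θ t), sin α * cos (φ t) * cos (θ t), sin (φ t)]

/-! Clairaut's integral and the unit speed condition turn both geodesics into one-dimensional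
motions: the latitude satisfies `y'² = W(y)` and `y'' = f(y)`, and the longitude has a speed of
constant sign depending on the latitude only.

The constants `a` and `b` are linked by the `e₃∧e₄`-coordinate. With `k = sin a cos a` and `x = sin²
ν`, its square is `1 - x - k²/x`, with maximum `1 - 2k` on the bipolar surface; on `J_b` the maximum
is `sin² b`. Hence `cos² b = 2k` (`cos_sq_eq_of_range_eq_bipolarSurface`). To compare `Ω(a)` with
`Ξ(b)`, solve `1 - x - k²/x = sin² φ` for `x` along the bipolar geodesic and substitute `ν = arcsin
√x`: both quantities become integrals over the same time interval, and their integrands differ by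
the derivative of `arctan (x sin φ / k)`, which vanishes at both ends (`Omega_eq_Xi`).

The latitude climbs from `b` to `-b` in a time `τ`. Uniqueness for the second-order equation makes
`φ` even and `φ(t + τ) = -φ(t)`, and each half period turns the longitude by `Ξ(b) = pπ/q`.
Coprimality gives `t₀ = 2qτ`, with total turn `2pπ`; the zeroes are counted from this.

Two points of the torus have the same image only if their latitudes agree and both angles agree or
both differ by `π`, modulo `2π`. Equal latitudes mean `s = ±t + 2jτ`. The minus sign is possible for
countably many `t` only, and the plus sign leaves the identity and, for even `q`, the half-period
shift. A continuous invariance is therefore determined on a dense set; connectedness forbids mixing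
the two cases. -/

/-! ### Autonomous second-order equations on the line. -/

/-- If a differentiable function converges at infinity and its derivative converges, then the
derivative converges to zero. -/
theorem eq_zero_of_tendsto_of_tendsto_deriv {y y' : ℝ → ℝ} {L l : ℝ}
    (hy : ∀ t, HasDerivAt y (y' t) t) (hL : Filter.Tendsto y Filter.atTop (nhds L))
    (hl : Filter.Tendsto y' Filter.atTop (nhds l)) : l = 0 := by
  -- By the mean value theorem, the derivative takes the value `y (t + 1) - y t`, which tends to
  -- `0`, at points tending to infinity.
  have h : ∀ t : ℝ, ∃ c ∈ Ioo t (t + 1), y' c = y (t + 1) - y t := by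
    intro t
    obtain ⟨c, hc, h⟩ := exists_hasDerivAt_eq_slope y y' (lt_add_one t)
      (fun x _ => (hy x).continuousAt.continuousWithinAt) (fun x _ => hy x)
    exact ⟨c, hc, by rw [h]; simp⟩
  choose c hc h using h
  have h1 : Filter.Tendsto c Filter.atTop Filter.atTop :=
    Filter.tendsto_atTop_mono (fun t => (hc t).1.le) Filter.tendsto_id
  have h2 : Filter.Tendsto (fun t => y' (c t)) Filter.atTop (nhds l) := hl.comp h1
  have h3 : Filter.Tendsto (fun t => y' (c t)) Filter.atTop (nhds (L - L)) := by
    simp only [h]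
    exact (hL.comp (Filter.tendsto_atTop_add_const_right _ _ Filter.tendsto_id)).sub hL
  rw [tendsto_nhds_unique h2 h3, sub_self]

/-- A solution of `y'' = f(y)`, `y'² = W(y)` that starts at a minimum `y₀` reaches the next
zero `y₁` of `W`, unless this is a stationary point. -/
theorem exists_turning_point {y y' f W : ℝ → ℝ} {y₀ y₁ : ℝ}
    (hy : ∀ t, HasDerivAt y (y' t) t) (hy' : ∀ t, HasDerivAt y' (f (y t)) t)
    (hmem : ∀ t, y t ∈ Icc y₀ y₁) (h0 : y 0 = y₀) (hW : ∀ t, y' t ^ 2 = W (y t))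
    (hWpos : ∀ u ∈ Ioo y₀ y₁, W u ≠ 0) (hWc : ContinuousOn W (Icc y₀ y₁))
    (hfc : ContinuousOn f (Icc y₀ y₁)) (hf0 : 0 < f y₀) (hf1 : f y₁ ≠ 0) :
    ∃ τ > 0, y' 0 = 0 ∧ y' τ = 0 ∧ y τ = y₁ ∧ (∀ t ∈ Ioo 0 τ, 0 < y' t) ∧
      StrictMonoOn y (Icc 0 τ) := by
  have hyc : Continuous y := continuous_iff_continuousAt.2 fun t => (hy t).continuousAt
  have hyc' : Continuous y' := continuous_iff_continuousAt.2 fun t => (hy' t).continuousAt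
  have hy0 : y' 0 = 0 := by
    refine IsLocalMin.hasDerivAt_eq_zero (f := y) (a := 0) ?_ (hy 0)
    exact Filter.Eventually.of_forall fun t => by simpa [h0] using (hmem t).1
  have mono : ∀ T : ℝ, (∀ t ∈ Ioo 0 T, 0 < y' t) → StrictMonoOn y (Icc 0 T) := by
    intro T hT
    refine strictMonoOn_of_deriv_pos (convex_Icc 0 T) hyc.continuousOn ?_
    intro t ht
    rw [interior_Icc] at ht
    rw [(hy t).deriv]
    exact hT t ht
  -- the velocity is positive right after time `0`
  obtain ⟨δ, hδ, hpos⟩ : ∃ δ > 0, ∀ t ∈ Ioc 0 δ, 0 < y' t := by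
    have h1 : ∀ᶠ t in nhds (0 : ℝ), 0 < f (y t) := by
      have h2 : Filter.Tendsto (fun t => f (y t)) (nhds 0) (nhds (f (y 0))) := by
        have := (hfc (y 0) (hmem 0)).tendsto
        exact this.comp (tendsto_nhdsWithin_iff.2 ⟨hyc.continuousAt,
          Filter.Eventually.of_forall hmem⟩)
      rw [h0] at h2
      exact h2.eventually (lt_mem_nhds hf0)
    obtain ⟨δ, hδ, h⟩ := Metric.eventually_nhds_iff.1 h1
    have h3 : StrictMonoOn y' (Icc 0 (δ / 2)) := by
      refine strictMonoOn_of_deriv_pos (convex_Icc _ _) hyc'.continuousOn ?_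
      intro t ht
      rw [interior_Icc] at ht
      rw [(hy' t).deriv]
      apply h
      rw [Real.dist_eq, abs_lt]
      constructor <;> linarith [ht.1, ht.2]
    refine ⟨δ / 2, by linarith, fun t ht => ?_⟩
    rw [← hy0]
    exact h3 ⟨le_rfl, by linarith⟩ ⟨ht.1.le, ht.2⟩ ht.1
  -- the velocity vanishes at a later time
  have hex : ∃ t, δ ≤ t ∧ y' t = 0 := by
    by_contra! hne
    have hall : ∀ t, 0 < t → 0 < y' t := by
      intro t ht
      rcases le_total t δ with h | h
      · exact hpos t ⟨ht, h⟩
      by_contra! hle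
      obtain ⟨c, hc, hc0⟩ := intermediate_value_Icc' h hyc'.continuousOn
        ⟨hle, (hpos δ ⟨hδ, le_rfl⟩).le⟩
      exact hne c hc.1 hc0
    -- Without a later zero `y` would increase to a limit `L`, so `y'` and then `y''` would tend to
    -- `0`. Then `W L = 0` and `f L = 0`: the first forces `L = y₁`, where the second is excluded.
    have hm : StrictMonoOn y (Ici 0) := fun s hs t ht hst =>
      mono t (fun u hu => hall u hu.1) ⟨hs, hst.le⟩ ⟨ht, le_rfl⟩ hst
    set z : ℝ → ℝ := fun t => y (max t 0)
    have hz : Monotone z := fun s t hst =>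
      hm.monotoneOn (mem_Ici.2 (le_max_right _ _)) (mem_Ici.2 (le_max_right _ _))
        (max_le_max_right 0 hst)
    obtain ⟨L, hL⟩ : ∃ L, Filter.Tendsto z Filter.atTop (nhds L) :=
      ⟨_, tendsto_atTop_ciSup hz ⟨y₁, by rintro _ ⟨t, rfl⟩; exact (hmem _).2⟩⟩
    have hyL : Filter.Tendsto y Filter.atTop (nhds L) := by
      refine hL.congr' ?_
      filter_upwards [Filter.eventually_ge_atTop 0] with t ht
      simp [z, ht]
    have hLm : L ∈ Icc y₀ y₁ := isClosed_Icc.mem_of_tendsto hyL (Filter.Eventually.of_forall hmem)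
    have hL0 : y₀ < L := by
      have h1 : y 1 ≤ L := by
        refine ge_of_tendsto hyL ?_
        filter_upwards [Filter.eventually_ge_atTop 1] with t ht
        exact hm.monotoneOn (by simp) (by simp; linarith) ht
      have h2 : y 0 < y 1 := hm (by simp) (by simp) one_pos
      rw [h0] at h2
      exact h2.trans_le h1
    have hcomp : ∀ g : ℝ → ℝ, ContinuousOn g (Icc y₀ y₁) →
        Filter.Tendsto (fun t => g (y t)) Filter.atTop (nhds (g L)) := fun g hg =>
      (hg L hLm).tendsto.comp (tendsto_nhdsWithin_iff.2 ⟨hyL, Filter.Eventually.of_forall hmem⟩)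
    have hsq : Filter.Tendsto y' Filter.atTop (nhds (√(W L))) := by
      refine ((hcomp W hWc).sqrt).congr' ?_
      filter_upwards [Filter.eventually_gt_atTop 0] with t ht
      rw [← hW, Real.sqrt_sq (hall t ht).le]
    have hs0 := eq_zero_of_tendsto_of_tendsto_deriv hy hyL hsq
    rw [hs0] at hsq
    have hf := eq_zero_of_tendsto_of_tendsto_deriv hy' hsq (hcomp f hfc)
    have hW0 : W L = 0 := by
      have h1 : Filter.Tendsto (fun t => y' t ^ 2) Filter.atTop (nhds (0 ^ 2)) := hsq.pow 2
      simp only [hW] at h1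
      simpa using tendsto_nhds_unique (hcomp W hWc) h1
    rcases hLm.2.lt_or_eq with h | h
    · exact hWpos L ⟨hL0, h⟩ hW0
    · exact hf1 (h ▸ hf)
  -- The bound `δ ≤ t` removes the zero at time `0` while keeping the set closed, so a first later
  -- zero exists.
  have hcl : IsClosed {t | δ ≤ t ∧ y' t = 0} :=
    isClosed_Ici.inter (isClosed_eq hyc' continuous_const)
  have hbdd : BddBelow {t | δ ≤ t ∧ y' t = 0} := ⟨δ, fun t ht => ht.1⟩
  obtain ⟨hτδ, hτ⟩ := hcl.csInf_mem hex hbdd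
  set τ := sInf {t | δ ≤ t ∧ y' t = 0}
  have hτpos : 0 < τ := hδ.trans_le hτδ
  have hpos' : ∀ t ∈ Ioo 0 τ, 0 < y' t := by
    intro t ht
    rcases le_total t δ with h | h
    · exact hpos t ⟨ht.1, h⟩
    by_contra! hle
    obtain ⟨c, hc, hc0⟩ := intermediate_value_Icc' h hyc'.continuousOn
      ⟨hle, (hpos δ ⟨hδ, le_rfl⟩).le⟩
    exact (csInf_le hbdd ⟨hc.1, hc0⟩).not_gt (hc.2.trans_lt ht.2)
  have hm := mono τ hpos'
  refine ⟨τ, hτpos, hy0, hτ, ?_, hpos', hm⟩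
  have h1 : y 0 < y τ := hm ⟨le_rfl, hτpos.le⟩ ⟨hτpos.le, le_rfl⟩ hτpos
  rw [h0] at h1
  by_contra hne
  exact hWpos (y τ) ⟨h1, lt_of_le_of_ne (hmem τ).2 hne⟩ (by rw [← hW, hτ]; norm_num)

/-- Uniqueness of the solution of `y'' = f(y)` with given initial position and velocity. -/
theorem second_order_ODE_unique {f : ℝ → ℝ} {s : Set ℝ} {K : NNReal} (hf : LipschitzOnWith K f s)
    {y y' z z' : ℝ → ℝ} (hy : ∀ t, HasDerivAt y (y' t) t) (hy' : ∀ t, HasDerivAt y' (f (y t)) t)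
    (hz : ∀ t, HasDerivAt z (z' t) t) (hz' : ∀ t, HasDerivAt z' (f (z t)) t)
    (hys : ∀ t, y t ∈ s) (hzs : ∀ t, z t ∈ s) {t₀ : ℝ} (h : y t₀ = z t₀) (h' : y' t₀ = z' t₀) :
    y = z := by
  have hl : LipschitzOnWith (max 1 (K * 1)) (fun x : ℝ × ℝ => (x.2, f x.1)) (s ×ˢ univ) :=
    (LipschitzWith.prod_snd.lipschitzOnWith).prodMk
      (hf.comp LipschitzWith.prod_fst.lipschitzOnWith fun x hx => hx.1)
  have := ODE_solution_unique_univ (v := fun _ x => (x.2, f x.1)) (s := fun _ => s ×ˢ univ)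
    (f := fun t => (y t, y' t)) (g := fun t => (z t, z' t)) (t₀ := t₀) (fun _ => hl)
    (fun t => ⟨(hy t).prodMk (hy' t), hys t, trivial⟩)
    (fun t => ⟨(hz t).prodMk (hz' t), hzs t, trivial⟩) (by simp [h, h'])
  funext t
  exact congrArg Prod.fst (congrFun this t)

/-! ### Counting zeroes in half-open intervals. -/

/-- A set with exactly one point in each interval `[x + jd, x + (j+1)d)` has `n` points in
`[x, x + nd)`. -/
theorem ncard_inter_Ico_of_existsUnique {S : Set ℝ} {x d : ℝ} (hd : 0 < d)
    (h : ∀ j : ℕ, ∃! s, s ∈ S ∧ s ∈ Ico (x + j * d) (x + (j + 1) * d)) (n : ℕ) :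
    (S ∩ Ico x (x + n * d)).ncard = n := by
  choose g hg hu using h
  have hi : Function.Injective g := by
    have : StrictMono g := strictMono_nat_of_lt_succ fun j => by
      have h1 := (hg j).2.2
      have h2 := (hg (j + 1)).2.1
      push_cast at h2
      linarith
    exact this.injective
  have : S ∩ Ico x (x + n * d) = g '' (Finset.range n : Set ℕ) := by
    ext s
    constructor
    · rintro ⟨hs, h1, h2⟩
      have h0 : 0 ≤ (s - x) / d := div_nonneg (by linarith) hd.le
      refine ⟨⌊(s - x) / d⌋₊, ?_, ?_⟩
      · simp only [Finset.coe_range, mem_Iio]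
        rw [Nat.floor_lt h0, div_lt_iff₀ hd]
        linarith
      · refine (hu _ s ⟨hs, ?_, ?_⟩).symm
        · have := Nat.floor_le h0
          rw [le_div_iff₀ hd] at this
          linarith
        · have := Nat.lt_floor_add_one ((s - x) / d)
          rw [div_lt_iff₀ hd] at this
          linarith
    · rintro ⟨j, hj, rfl⟩
      simp only [Finset.coe_range, mem_Iio] at hj
      refine ⟨(hg j).1, le_trans ?_ (hg j).2.1, (hg j).2.2.trans_le ?_⟩
      · have : 0 ≤ (j : ℝ) * d := by positivity
        linarith
      · have : ((j : ℝ) + 1) ≤ n := by exact_mod_cast hj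
        nlinarith
  rw [this, Set.ncard_image_of_injective _ hi, Set.ncard_coe_finset, Finset.card_range]

/-- `sin` has `n` zeros in an interval `[x, x + nπ)`. -/
theorem ncard_sin_eq_zero_Ico (x : ℝ) (n : ℕ) :
    ({s : ℝ | sin s = 0} ∩ Ico x (x + n * π)).ncard = n := by
  refine ncard_inter_Ico_of_existsUnique pi_pos (fun j => ?_) n
  obtain ⟨m, hm, hu⟩ := existsUnique_add_zsmul_mem_Ico pi_pos 0 (x + j * π)
  simp only [zero_add, zsmul_eq_mul] at hm hu
  refine ⟨m * π, ⟨sin_int_mul_pi m, hm.1, by linarith [hm.2]⟩, ?_⟩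
  rintro s ⟨hs, h1, h2⟩
  obtain ⟨k, rfl⟩ := sin_eq_zero_iff.1 hs
  rw [hu k ⟨h1, by linarith⟩]

/-- `cos` has `n` zeros in an interval `[x, x + nπ)`. -/
theorem ncard_cos_eq_zero_Ico (x : ℝ) (n : ℕ) :
    ({s : ℝ | cos s = 0} ∩ Ico x (x + n * π)).ncard = n := by
  have h : {s : ℝ | sin s = 0} ∩ Ico (x + π / 2) (x + π / 2 + n * π) =
      (fun s => s + π / 2) '' ({s : ℝ | cos s = 0} ∩ Ico x (x + n * π)) := by
    ext s
    constructor
    · rintro ⟨hs, h1, h2⟩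
      refine ⟨s - π / 2, ⟨?_, ?_, ?_⟩, by simp⟩
      · rw [mem_ofPred_eq, cos_sub_pi_div_two]; exact hs
      · linarith
      · linarith
    · rintro ⟨s, ⟨hs, h1, h2⟩, rfl⟩
      refine ⟨?_, ?_, ?_⟩
      · rw [mem_ofPred_eq, sin_add_pi_div_two]; exact hs
      · simpa using h1
      · simp only; linarith
  have h' := ncard_sin_eq_zero_Ico (x + π / 2) n
  rwa [h, Set.ncard_image_of_injective _ (add_left_injective _)] at h'

/-! ### First integrals of geodesics. -/

theorem IsUnitSpeedGeodesic.hasDerivAt_fst {E G x y : ℝ → ℝ} (h : IsUnitSpeedGeodesic E G x y)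
    (t : ℝ) : HasDerivAt x (deriv x t) t :=
  (h.contDiff_fst.differentiable (by norm_num) t).hasDerivAt

theorem IsUnitSpeedGeodesic.hasDerivAt_snd {E G x y : ℝ → ℝ} (h : IsUnitSpeedGeodesic E G x y)
    (t : ℝ) : HasDerivAt y (deriv y t) t :=
  (h.contDiff_snd.differentiable (by norm_num) t).hasDerivAt

theorem ContDiff.hasDerivAt_deriv {x : ℝ → ℝ} (h : ContDiff ℝ 2 x) (t : ℝ) :
    HasDerivAt (deriv x) (deriv (deriv x) t) t := by
  have h2 : ContDiff ℝ (1 + 1) x := by norm_num; exact h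
  exact ((contDiff_succ_iff_deriv.1 h2).2.2.differentiable (by norm_num) t).hasDerivAt

/-- Clairaut's first integral of a geodesic. -/
theorem IsUnitSpeedGeodesic.clairaut {E G x y : ℝ → ℝ} (h : IsUnitSpeedGeodesic E G x y)
    (hG : Differentiable ℝ G) (t : ℝ) : G (x t) * deriv y t = G (x 0) * deriv y 0 := by
  have hd : ∀ t, HasDerivAt (fun t => G (x t) * deriv y t) 0 t := by
    intro t
    have h1 := ((hG (x t)).hasDerivAt.comp t (h.hasDerivAt_fst t)).mul
      (h.contDiff_snd.hasDerivAt_deriv t)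
    refine h1.congr_deriv ?_
    have := h.geodesic_snd t
    rw [Function.comp_apply]
    linarith
  exact is_const_of_deriv_eq_zero (fun t => (hd t).differentiableAt) (fun t => (hd t).deriv) t 0

/-- The sign of the longitudinal velocity: Clairaut's integral is `± √G` at a minimum. -/
theorem IsUnitSpeedGeodesic.exists_sign {E G x y : ℝ → ℝ} (h : IsUnitSpeedGeodesic E G x y)
    (hG : Differentiable ℝ G) (hmin : ∀ t, x 0 ≤ x t) {g : ℝ}
    (hg2 : G (x 0) = g ^ 2) :
    ∃ ε : ℝ, (ε = 1 ∨ ε = -1) ∧ ∀ t, G (x t) * deriv y t = ε * g := by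
  -- At the minimum the velocity is purely longitudinal, so unit speed reads `(g y')² = 1`.
  have h0 : deriv x 0 = 0 :=
    IsLocalMin.deriv_eq_zero (Filter.Eventually.of_forall hmin)
  have h1 := h.unit_speed 0
  rw [h0, hg2] at h1
  have h2 : (g * deriv y 0) ^ 2 = 1 := by linarith
  refine ⟨g * deriv y 0, mul_self_eq_one_iff.1 (by rw [← sq]; exact h2), fun t => ?_⟩
  rw [h.clairaut hG, hg2]
  ring

/-! ### The latitude of the bipolar geodesic. -/

namespace IsBipolarGeodesic

variable {b : ℝ} {φ θ : ℝ → ℝ}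

theorem cos_pos (h : IsBipolarGeodesic b φ θ) (t : ℝ) : 0 < cos (φ t) :=
  cos_pos_of_mem_Ioo (h.mem_Ioo t)

theorem cos_b_pos (h : IsBipolarGeodesic b φ θ) : 0 < cos b := h.apply_zero ▸ h.cos_pos 0

theorem exists_hasDerivAt_snd (h : IsBipolarGeodesic b φ θ) :
    ∃ ε : ℝ, (ε = 1 ∨ ε = -1) ∧
      ∀ t, HasDerivAt θ (ε * (cos b ^ 2 / (2 * π * cos (φ t) ^ 4))) t := by
  have hb := h.cos_b_pos
  obtain ⟨ε, hε, he⟩ := h.geodesic.exists_sign (by fun_prop)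
    (fun t => h.apply_zero.symm ▸ h.min_le t) (g := 2 * π * cos b ^ 2)
    (by rw [h.apply_zero]; ring)
  refine ⟨ε, hε, fun t => ?_⟩
  have h1 := h.geodesic.hasDerivAt_snd t
  have h2 := he t
  have h3 := h.cos_pos t
  refine h1.congr_deriv ?_
  field_simp at h2 ⊢
  linarith

theorem deriv_snd_sq (h : IsBipolarGeodesic b φ θ) (t : ℝ) :
    deriv θ t ^ 2 = cos b ^ 4 / (4 * π ^ 2 * cos (φ t) ^ 8) := by
  obtain ⟨ε, hε, he⟩ := h.exists_hasDerivAt_snd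
  have h3 := h.cos_pos t
  rw [(he t).deriv]
  have : ε ^ 2 = 1 := by rcases hε with rfl | rfl <;> norm_num
  rw [mul_pow, this]
  field_simp
  norm_num

theorem deriv_fst_sq (h : IsBipolarGeodesic b φ θ) (t : ℝ) :
    deriv φ t ^ 2 = (cos (φ t) ^ 4 - cos b ^ 4) / (4 * π ^ 2 * cos (φ t) ^ 6) := by
  have h1 := h.geodesic.unit_speed t
  have h3 := h.cos_pos t
  simp only [h.deriv_snd_sq] at h1
  field_simp at h1 ⊢
  linarith

/-- Substituting both squared velocities into the geodesic equation leaves a function of the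
latitude alone: the equation is autonomous. -/
theorem deriv_deriv_fst (h : IsBipolarGeodesic b φ θ) (t : ℝ) :
    deriv (deriv φ) t =
      sin (φ t) * (cos (φ t) ^ 4 - 3 * cos b ^ 4) / (4 * π ^ 2 * cos (φ t) ^ 7) := by
  have h1 := h.geodesic.geodesic_fst t
  have h3 := h.cos_pos t
  have hE : ∀ x, deriv (fun s => (2 * π * cos s) ^ 2) x = -(8 * π ^ 2 * cos x * sin x) := by
    intro x
    refine ((((hasDerivAt_cos x).const_mul (2 * π)).fun_pow 2).congr_deriv ?_).deriv
    push_cast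
    ring
  have hG : ∀ x, deriv (fun s => (2 * π * cos s) ^ 2 * cos s ^ 2) x =
      -(16 * π ^ 2 * cos x ^ 3 * sin x) := by
    intro x
    refine (((((hasDerivAt_cos x).const_mul (2 * π)).fun_pow 2).fun_mul
      ((hasDerivAt_cos x).fun_pow 2)).congr_deriv ?_).deriv
    push_cast
    ring
  simp only [hE, hG, h.deriv_snd_sq, h.deriv_fst_sq] at h1
  field_simp at h1 ⊢
  linarith

theorem abs_fst_le (h : IsBipolarGeodesic b φ θ) (t : ℝ) : |φ t| ≤ |b| := by
  have h1 := h.deriv_fst_sq t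
  have h3 := h.cos_pos t
  have hb := h.cos_b_pos
  have h4 : cos b ^ 4 ≤ cos (φ t) ^ 4 := by
    have : 0 ≤ (cos (φ t) ^ 4 - cos b ^ 4) / (4 * π ^ 2 * cos (φ t) ^ 6) := h1 ▸ sq_nonneg _
    rw [le_div_iff₀ (by positivity)] at this
    linarith
  have h5 : cos b ≤ cos (φ t) := le_of_pow_le_pow_left₀ (by norm_num) h3.le h4
  by_contra! hlt
  have hm := h.mem_Ioo t
  have := cos_lt_cos_of_nonneg_of_le_pi (abs_nonneg b)
    ((abs_lt.2 hm).le.trans (by linarith [pi_pos])) hlt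
  rw [cos_abs, cos_abs] at this
  linarith

/-- For `b > 0` the bounds `b ≤ φ` and `|φ| ≤ |b|` force a constant latitude, but a parallel other
than the equator is not a geodesic. -/
theorem b_nonpos (h : IsBipolarGeodesic b φ θ) : b ≤ 0 := by
  by_contra! hb
  have hc : φ = fun _ => b := by
    funext t
    have h1 := (le_abs_self _).trans (h.abs_fst_le t)
    rw [abs_of_pos hb] at h1
    exact le_antisymm h1 (h.min_le t)
  have h1 := h.deriv_deriv_fst 0
  have h2 := h.cos_b_pos
  have h3 : 0 < sin b := sin_pos_of_pos_of_lt_pi hb (by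
    have := (h.mem_Ioo 0).2
    rw [h.apply_zero] at this
    linarith [pi_pos])
  simp only [hc, deriv_const'] at h1
  rw [eq_comm, div_eq_zero_iff] at h1
  rcases h1 with h1 | h1
  · have : 0 < sin b * cos b ^ 4 := by positivity
    linarith
  · have : 0 < 4 * π ^ 2 * cos b ^ 7 := by positivity
    linarith

theorem mem_Icc (h : IsBipolarGeodesic b φ θ) (t : ℝ) : φ t ∈ Icc b (-b) := by
  have h1 := h.abs_fst_le t
  rw [abs_of_nonpos h.b_nonpos] at h1
  exact ⟨h.min_le t, (le_abs_self _).trans h1⟩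

/-- The acceleration of the latitude along a geodesic with minimal value `b`. -/
noncomputable def accel (b u : ℝ) : ℝ :=
  sin u * (cos u ^ 4 - 3 * cos b ^ 4) / (4 * π ^ 2 * cos u ^ 7)

theorem accel_neg (b u : ℝ) : accel b (-u) = -accel b u := by
  simp only [accel, cos_neg, sin_neg]
  ring

theorem hasDerivAt_deriv_fst (h : IsBipolarGeodesic b φ θ) (t : ℝ) :
    HasDerivAt (deriv φ) (accel b (φ t)) t := by
  rw [accel, ← h.deriv_deriv_fst]
  exact h.geodesic.contDiff_fst.hasDerivAt_deriv t

theorem cos_pos_of_mem_Icc (h : IsBipolarGeodesic b φ θ) {u : ℝ} (hu : u ∈ Icc b (-b)) :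
    0 < cos u := by
  have h0 := h.mem_Ioo 0
  rw [h.apply_zero] at h0
  exact cos_pos_of_mem_Ioo ⟨h0.1.trans_le hu.1, hu.2.trans_lt (by linarith [h0.1])⟩

theorem contDiffOn_accel (h : IsBipolarGeodesic b φ θ) : ContDiffOn ℝ 1 (accel b) (Icc b (-b)) := by
  unfold accel
  refine ContDiffOn.div (by fun_prop) (by fun_prop) fun u hu => ?_
  have := h.cos_pos_of_mem_Icc hu
  positivity

theorem exists_lipschitzOnWith_accel (h : IsBipolarGeodesic b φ θ) :
    ∃ K, LipschitzOnWith K (accel b) (Icc b (-b)) := by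
  refine ContDiffOn.exists_lipschitzOnWith h.contDiffOn_accel (by norm_num) (convex_Icc _ _)
    isCompact_Icc

theorem cos_b_lt (h : IsBipolarGeodesic b φ θ) {u : ℝ} (hu : u ∈ Ioo b (-b)) :
    cos b < cos u := by
  have h0 := h.mem_Ioo 0
  rw [h.apply_zero] at h0
  have h1 : |u| < |b| := by
    rw [abs_of_nonpos h.b_nonpos, abs_lt]
    exact ⟨by linarith [hu.1], hu.2⟩
  rw [← cos_abs b, ← cos_abs u]
  refine cos_lt_cos_of_nonneg_of_le_pi (abs_nonneg _) ?_ h1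
  rw [abs_of_nonpos h.b_nonpos]
  linarith [h0.1, pi_pos]

/-- The ends `b` and `-b` are consecutive zeroes of `φ'²` as a function of the latitude, and since
`b < 0` the acceleration is nonzero at both, so neither is a stationary point. -/
theorem exists_half_period (h : IsBipolarGeodesic b φ θ) (hb : b < 0) :
    ∃ τ > 0, deriv φ 0 = 0 ∧ deriv φ τ = 0 ∧ φ τ = -b ∧ (∀ t ∈ Ioo 0 τ, 0 < deriv φ t) ∧
      StrictMonoOn φ (Icc 0 τ) := by
  have hcb := h.cos_b_pos
  have hpos : 0 < accel b b := by
    have h0 := h.mem_Ioo 0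
    rw [h.apply_zero] at h0
    have h1 : sin b < 0 := sin_neg_of_neg_of_neg_pi_lt hb (by linarith [h0.1, pi_pos])
    have h2 : accel b b = -sin b * (2 * cos b ^ 4) / (4 * π ^ 2 * cos b ^ 7) := by
      rw [accel]; ring
    rw [h2]
    have : 0 < -sin b := by linarith
    positivity
  refine exists_turning_point (f := accel b)
    (W := fun u => (cos u ^ 4 - cos b ^ 4) / (4 * π ^ 2 * cos u ^ 6)) h.geodesic.hasDerivAt_fst
    h.hasDerivAt_deriv_fst h.mem_Icc h.apply_zero h.deriv_fst_sq ?_ ?_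
    h.contDiffOn_accel.continuousOn hpos ?_
  · intro u hu
    have h1 := h.cos_b_lt hu
    have h2 : cos b ^ 4 < cos u ^ 4 := pow_lt_pow_left₀ h1 hcb.le (by norm_num)
    have h3 : 0 < cos u ^ 4 - cos b ^ 4 := by linarith
    have h4 := hcb.trans h1
    positivity
  · refine ContinuousOn.div (by fun_prop) (by fun_prop) fun u hu => ?_
    have := h.cos_pos_of_mem_Icc hu
    positivity
  · rw [accel_neg]
    linarith

end IsBipolarGeodesic

/-! ### The Otsuki geodesic and its unit normal. -/

theorem HasDerivAt.toLp {ι : Type*} [Fintype ι] {f : ℝ → ι → ℝ} {f' : ι → ℝ} {t : ℝ}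
    (h : HasDerivAt f f' t) (p : ENNReal) [Fact (1 ≤ p)] :
    HasDerivAt (fun s => WithLp.toLp p (f s)) (WithLp.toLp p f') t :=
  (PiLp.continuousLinearEquiv p ℝ (fun _ : ι => ℝ)).symm.hasFDerivAt.comp_hasDerivAt t h

/-- Linear algebra of a unit vector `n` orthogonal to the rotation surface over a curve on the
sphere with velocity `(u, w)` at latitude and longitude with sines `s, sl` and cosines `c, cl`. -/
theorem normal_coordinate_sq {s c sa ca sl cl u w n0 n1 n2 n3 : ℝ} (hs : s ≠ 0)
    (hsc : s ^ 2 + c ^ 2 = 1) (ha : sa ^ 2 + ca ^ 2 = 1) (hl : sl ^ 2 + cl ^ 2 = 1)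
    (hn : n0 ^ 2 + n1 ^ 2 + n2 ^ 2 + n3 ^ 2 = 1)
    (h2 : n0 * (ca * s) + n1 * (sa * s) + n2 * (c * cl) + n3 * (c * sl) = 0)
    (h3 : n0 * (-sa * s) + n1 * (ca * s) + n2 * 0 + n3 * 0 = 0)
    (h4 : n0 * (ca * (c * u)) + n1 * (sa * (c * u)) + n2 * (-s * u * cl + c * (-sl * w)) +
      n3 * (-s * u * sl + c * (cl * w)) = 0) :
    (c * cl * n3 - c * sl * n2) ^ 2 * (u ^ 2 + c ^ 2 * w ^ 2) = c ^ 2 * u ^ 2 := by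
  have hB : -sa * n0 + ca * n1 = 0 := by
    have : s * (-sa * n0 + ca * n1) = 0 := by linear_combination h3
    exact (mul_eq_zero.1 this).resolve_left hs
  -- `A`, `P`, `Q` are components of `n` in a rotated orthonormal frame; the fourth, along the
  -- rotation orbits, vanishes by `hB`. Thus `n` has only the meridian component `c A - s P` and the
  -- longitudinal component `Q`, and is orthogonal to the velocity `(u, c w)`.
  obtain ⟨A, hA⟩ : ∃ A, A = ca * n0 + sa * n1 := ⟨_, rfl⟩
  obtain ⟨P, hP⟩ : ∃ P, P = cl * n2 + sl * n3 := ⟨_, rfl⟩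
  obtain ⟨Q, hQ⟩ : ∃ Q, Q = cl * n3 - sl * n2 := ⟨_, rfl⟩
  have e1 : A ^ 2 + P ^ 2 + Q ^ 2 = 1 := by
    rw [hA, hP, hQ]
    linear_combination hn + (n0 ^ 2 + n1 ^ 2) * ha + (n2 ^ 2 + n3 ^ 2) * hl -
      (-sa * n0 + ca * n1) * hB
  have e2 : s * A + c * P = 0 := by rw [hA, hP]; linear_combination h2
  have e3 : u * (c * A - s * P) + c * w * Q = 0 := by
    rw [hA, hP, hQ]; linear_combination h4
  have e4 : (c * A - s * P) ^ 2 + Q ^ 2 = 1 := by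
    linear_combination e1 + (A ^ 2 + P ^ 2) * hsc - (s * A + c * P) * e2
  have e5 : Q ^ 2 * (u ^ 2 + c ^ 2 * w ^ 2) = u ^ 2 := by
    linear_combination u ^ 2 * e4 + (c * w * Q - u * (c * A - s * P)) * e3
  have e6 : c * cl * n3 - c * sl * n2 = c * Q := by rw [hQ]; ring
  rw [e6]
  linear_combination c ^ 2 * e5

namespace IsOtsukiGeodesic

variable {a : ℝ} {ν lam : ℝ → ℝ}

theorem sin_pos (h : IsOtsukiGeodesic a ν lam) (t : ℝ) : 0 < sin (ν t) :=
  sin_pos_of_pos_of_lt_pi (h.mem_Ioo t).1 (by linarith [(h.mem_Ioo t).2, pi_pos])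

theorem cos_pos (h : IsOtsukiGeodesic a ν lam) (t : ℝ) : 0 < cos (ν t) :=
  cos_pos_of_mem_Ioo ⟨by linarith [(h.mem_Ioo t).1, pi_pos], (h.mem_Ioo t).2⟩

theorem deriv_snd_sq (h : IsOtsukiGeodesic a ν lam) (t : ℝ) :
    deriv lam t ^ 2 = (sin a * cos a) ^ 2 / (4 * π ^ 2 * (sin (ν t) * cos (ν t)) ^ 4) := by
  have h1 := h.sin_pos t
  have h2 := h.cos_pos t
  have h3 : 0 < sin a := h.apply_zero ▸ h.sin_pos 0
  have h4 : 0 < cos a := h.apply_zero ▸ h.cos_pos 0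
  obtain ⟨ε, hε, he⟩ := h.geodesic.exists_sign (by fun_prop)
    (fun t => h.apply_zero.symm ▸ h.min_le t) (g := 2 * π * (sin a * cos a))
    (by rw [h.apply_zero]; ring)
  have h5 : ε ^ 2 = 1 := by rcases hε with rfl | rfl <;> norm_num
  have h6 : deriv lam t = ε * (sin a * cos a) / (2 * π * (sin (ν t) * cos (ν t)) ^ 2) := by
    have := he t
    field_simp at this ⊢
    linarith
  rw [h6, div_pow, mul_pow, h5]
  field_simp
  norm_num

theorem deriv_fst_sq (h : IsOtsukiGeodesic a ν lam) (t : ℝ) :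
    deriv ν t ^ 2 = ((sin (ν t) * cos (ν t)) ^ 2 - (sin a * cos a) ^ 2) /
      (4 * π ^ 2 * sin (ν t) ^ 4 * cos (ν t) ^ 2) := by
  have h1 := h.geodesic.unit_speed t
  have h2 := h.cos_pos t
  have h3 := h.sin_pos t
  simp only [h.deriv_snd_sq] at h1
  field_simp at h1 ⊢
  linarith

/-- The acceleration of the latitude along a geodesic with minimal value `a`. -/
noncomputable def accel (a u : ℝ) : ℝ :=
  -(cos u / sin u) * (((sin u * cos u) ^ 2 - (sin a * cos a) ^ 2) /
      (4 * π ^ 2 * sin u ^ 4 * cos u ^ 2) -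
    (cos u ^ 2 - sin u ^ 2) * ((sin a * cos a) ^ 2 / (4 * π ^ 2 * (sin u * cos u) ^ 4)))

theorem deriv_deriv_fst (h : IsOtsukiGeodesic a ν lam) (t : ℝ) :
    deriv (deriv ν) t = accel a (ν t) := by
  have h1 := h.geodesic.geodesic_fst t
  have h2 := h.cos_pos t
  have h3 := h.sin_pos t
  have hE : ∀ x, deriv (fun s => (2 * π * sin s) ^ 2) x = 8 * π ^ 2 * sin x * cos x := by
    intro x
    refine ((((hasDerivAt_sin x).const_mul (2 * π)).fun_pow 2).congr_deriv ?_).deriv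
    push_cast
    ring
  have hG : ∀ x, deriv (fun s => (2 * π * sin s) ^ 2 * cos s ^ 2) x =
      8 * π ^ 2 * sin x * cos x * (cos x ^ 2 - sin x ^ 2) := by
    intro x
    refine (((((hasDerivAt_sin x).const_mul (2 * π)).fun_pow 2).fun_mul
      ((hasDerivAt_cos x).fun_pow 2)).congr_deriv ?_).deriv
    push_cast
    ring
  rw [accel, ← h.deriv_snd_sq, ← h.deriv_fst_sq]
  simp only [hE, hG] at h1
  have h4 : (4 * π ^ 2 * sin (ν t)) * (sin (ν t) * deriv (deriv ν) t +
      cos (ν t) * (deriv ν t ^ 2 - (cos (ν t) ^ 2 - sin (ν t) ^ 2) * deriv lam t ^ 2)) = 0 := by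
    linarith
  have h5 := (mul_eq_zero.1 h4).resolve_left (by positivity)
  field_simp
  linarith

theorem sin_mul_cos_le (h : IsOtsukiGeodesic a ν lam) (t : ℝ) :
    sin a * cos a ≤ sin (ν t) * cos (ν t) := by
  have h1 := h.deriv_fst_sq t
  have h2 := h.cos_pos t
  have h3 := h.sin_pos t
  have h4 : 0 ≤ ((sin (ν t) * cos (ν t)) ^ 2 - (sin a * cos a) ^ 2) /
      (4 * π ^ 2 * sin (ν t) ^ 4 * cos (ν t) ^ 2) := h1 ▸ sq_nonneg _
  rw [le_div_iff₀ (by positivity)] at h4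
  exact le_of_sq_le_sq (by linarith) (by positivity)

theorem mem_Icc (h : IsOtsukiGeodesic a ν lam) (ha : a ∈ Ioo 0 (π / 4)) (t : ℝ) :
    ν t ∈ Icc a (π / 2 - a) := by
  refine ⟨h.min_le t, ?_⟩
  by_contra! hlt
  have h1 := h.sin_mul_cos_le t
  have h2 : sin (2 * (π / 2 - ν t)) < sin (2 * a) := by
    have := (h.mem_Ioo t).2
    refine sin_lt_sin_of_lt_of_le_pi_div_two ?_ ?_ ?_ <;> linarith [ha.1, ha.2, pi_pos]
  rw [sin_two_mul, sin_two_mul, sin_pi_div_two_sub, cos_pi_div_two_sub] at h2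
  linarith

theorem sin_mul_cos_lt (ha : a ∈ Ioo 0 (π / 4)) {u : ℝ} (hu : u ∈ Ioo a (π / 2 - a)) :
    sin a * cos a < sin u * cos u := by
  suffices sin (2 * a) < sin (2 * u) by
    rw [sin_two_mul, sin_two_mul] at this
    linarith
  rcases le_total u (π / 4) with h | h
  · refine sin_lt_sin_of_lt_of_le_pi_div_two ?_ ?_ ?_ <;> linarith [ha.1, ha.2, pi_pos, hu.1]
  · rw [← sin_pi_sub (2 * u)]
    refine sin_lt_sin_of_lt_of_le_pi_div_two ?_ ?_ ?_ <;> linarith [ha.1, ha.2, pi_pos, hu.2]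

/-- The latitude reaches its upper bound `π/2 - a`. -/
theorem exists_eq_max (h : IsOtsukiGeodesic a ν lam) (ha : a ∈ Ioo 0 (π / 4)) :
    ∃ τ, ν τ = π / 2 - a := by
  have hpi := pi_pos
  have hs : ∀ u ∈ Icc a (π / 2 - a), 0 < sin u := fun u hu =>
    sin_pos_of_pos_of_lt_pi (ha.1.trans_le hu.1) (by linarith [hu.2, ha.1])
  have hc : ∀ u ∈ Icc a (π / 2 - a), 0 < cos u := fun u hu =>
    cos_pos_of_mem_Ioo ⟨by linarith [hu.1, ha.1], by linarith [hu.2, ha.1]⟩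
  have hle : a ≤ π / 2 - a := by linarith [ha.2]
  have hsa := hs a ⟨le_rfl, hle⟩
  have hca := hc a ⟨le_rfl, hle⟩
  have hlt : sin a < cos a := by
    rw [← cos_pi_div_two_sub]
    refine cos_lt_cos_of_nonneg_of_le_pi ?_ ?_ ?_ <;> linarith [ha.1, ha.2]
  have hd : 0 < cos a ^ 2 - sin a ^ 2 := by
    have := pow_lt_pow_left₀ hlt hsa.le two_ne_zero
    linarith
  refine (exists_turning_point (f := accel a)
    (W := fun u => ((sin u * cos u) ^ 2 - (sin a * cos a) ^ 2) /
      (4 * π ^ 2 * sin u ^ 4 * cos u ^ 2)) h.geodesic.hasDerivAt_fst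
    (fun t => h.deriv_deriv_fst t ▸ h.geodesic.contDiff_fst.hasDerivAt_deriv t)
    (h.mem_Icc ha) h.apply_zero h.deriv_fst_sq ?_ ?_ ?_ ?_ ?_).imp fun τ h => h.2.2.2.1
  · intro u hu
    have h1 := pow_lt_pow_left₀ (sin_mul_cos_lt ha hu) (by positivity) two_ne_zero
    have h2 := hs u (Ioo_subset_Icc_self hu)
    have h3 := hc u (Ioo_subset_Icc_self hu)
    have h4 : 0 < (sin u * cos u) ^ 2 - (sin a * cos a) ^ 2 := by linarith
    positivity
  · refine ContinuousOn.div (by fun_prop) (by fun_prop) fun u hu => ?_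
    have h2 := hs u hu
    have h3 := hc u hu
    positivity
  · unfold accel
    refine ContinuousOn.mul (ContinuousOn.neg (ContinuousOn.div (by fun_prop) (by fun_prop) ?_))
      (ContinuousOn.sub (ContinuousOn.div (by fun_prop) (by fun_prop) ?_)
        (ContinuousOn.mul (by fun_prop) (ContinuousOn.div (by fun_prop) (by fun_prop) ?_)))
    all_goals
      intro u hu
      have h2 := hs u hu
      have h3 := hc u hu
      positivity
  · have h1 : accel a a = cos a / sin a *
        ((cos a ^ 2 - sin a ^ 2) * ((sin a * cos a) ^ 2 / (4 * π ^ 2 * (sin a * cos a) ^ 4))) := by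
      rw [accel]; ring
    rw [h1]
    positivity
  · have h1 : accel a (π / 2 - a) = -(sin a / cos a *
        ((cos a ^ 2 - sin a ^ 2) *
          ((sin a * cos a) ^ 2 / (4 * π ^ 2 * (sin a * cos a) ^ 4)))) := by
      rw [accel, sin_pi_div_two_sub, cos_pi_div_two_sub]; ring
    rw [h1, neg_ne_zero]
    positivity

/-- Some point of the geodesic has `sin² ν = sin a cos a`. -/
theorem exists_sin_sq_eq (h : IsOtsukiGeodesic a ν lam) (ha : a ∈ Ioo 0 (π / 4)) :
    ∃ t, sin (ν t) ^ 2 = sin a * cos a := by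
  obtain ⟨τ, hτ⟩ := h.exists_eq_max ha
  have hc : Continuous fun t => sin (ν t) ^ 2 := by
    have := h.geodesic.contDiff_fst.continuous
    fun_prop
  have hsa : 0 < sin a := h.apply_zero ▸ h.sin_pos 0
  have hca : 0 < cos a := h.apply_zero ▸ h.cos_pos 0
  have hlt : sin a < cos a := by
    rw [← cos_pi_div_two_sub]
    refine cos_lt_cos_of_nonneg_of_le_pi ?_ ?_ ?_ <;> linarith [ha.1, ha.2]
  -- `sin² ν` takes the values `sin² a` and `cos² a`, and `sin a cos a` is their geometric mean.
  refine mem_range_of_exists_le_of_exists_ge hc ⟨0, ?_⟩ ⟨τ, ?_⟩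
  · rw [h.apply_zero]; nlinarith
  · rw [hτ, sin_pi_div_two_sub]; nlinarith

/-- The square of the `e₃∧e₄`-coordinate of the bipolar surface. -/
theorem wedge_five_sq (h : IsOtsukiGeodesic a ν lam) {N : ℝ → ℝ → EuclideanSpace ℝ (Fin 4)}
    (hN : IsUnitNormalField (otsukiImmersion ν lam) N) (α t : ℝ) :
    (wedge (otsukiImmersion ν lam α t) (N α t) 5) ^ 2 =
      1 - sin (ν t) ^ 2 - (sin a * cos a) ^ 2 / sin (ν t) ^ 2 := by
  have hs := h.sin_pos t
  have hc := h.cos_pos t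
  have h1 := hN.norm_eq_one α t
  have h2 := hN.tangent_sphere α t
  have h3 := hN.normal_fst α t
  have h4 := hN.normal_snd α t
  have hν := h.geodesic.hasDerivAt_fst t
  have hl := h.geodesic.hasDerivAt_snd t
  have d1 : HasDerivAt (fun β => otsukiImmersion ν lam β t)
      (WithLp.toLp 2 ![-sin α * sin (ν t), cos α * sin (ν t), 0, 0]) α := by
    refine (hasDerivAt_pi.2 fun i => ?_).toLp 2
    fin_cases i <;> simp
    · simpa using (hasDerivAt_cos α).mul_const (sin (ν t))
    · exact (hasDerivAt_sin α).mul_const (sin (ν t))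
    · exact hasDerivAt_const _ _
    · exact hasDerivAt_const _ _
  have d2 : HasDerivAt (fun s => otsukiImmersion ν lam α s)
      (WithLp.toLp 2 ![cos α * (cos (ν t) * deriv ν t), sin α * (cos (ν t) * deriv ν t),
        -sin (ν t) * deriv ν t * cos (lam t) + cos (ν t) * (-sin (lam t) * deriv lam t),
        -sin (ν t) * deriv ν t * sin (lam t) + cos (ν t) * (cos (lam t) * deriv lam t)]) t := by
    refine (hasDerivAt_pi.2 fun i => ?_).toLp 2
    fin_cases i
    · exact hν.sin.const_mul (cos α)
    · exact hν.sin.const_mul (sin α)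
    · exact hν.cos.mul hl.cos
    · exact hν.cos.mul hl.sin
  rw [d1.deriv] at h3
  rw [d2.deriv] at h4
  have h1' : N α t 0 ^ 2 + N α t 1 ^ 2 + N α t 2 ^ 2 + N α t 3 ^ 2 = 1 := by
    have := EuclideanSpace.real_norm_sq_eq (N α t)
    rw [h1, Fin.sum_univ_four] at this
    linarith
  simp only [PiLp.inner_apply, Fin.sum_univ_four, otsukiImmersion, RCLike.inner_apply,
    conj_trivial] at h2 h3 h4
  have key : wedge (otsukiImmersion ν lam α t) (N α t) 5 =
      cos (ν t) * cos (lam t) * N α t 3 - cos (ν t) * sin (lam t) * N α t 2 := rfl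
  have alg := normal_coordinate_sq hs.ne' (sin_sq_add_cos_sq (ν t)) (sin_sq_add_cos_sq α)
    (sin_sq_add_cos_sq (lam t)) h1' h2 h3 h4
  have hu := h.geodesic.unit_speed t
  have hd := h.deriv_fst_sq t
  have hw : (wedge (otsukiImmersion ν lam α t) (N α t) 5) ^ 2 =
      4 * π ^ 2 * sin (ν t) ^ 2 * cos (ν t) ^ 2 * deriv ν t ^ 2 := by
    rw [key]
    linear_combination (4 * π ^ 2 * sin (ν t) ^ 2) * alg -
      (cos (ν t) * cos (lam t) * N α t 3 - cos (ν t) * sin (lam t) * N α t 2) ^ 2 * hu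
  rw [hw, hd, ← cos_sq']
  field_simp

end IsOtsukiGeodesic

/-! ### Comparison of the two parametrizations of the bipolar surface. -/

/-- The minimal latitudes of the Otsuki geodesic and of the geodesic that parametrizes the bipolar
surface. -/
theorem cos_sq_eq_of_range_eq_bipolarSurface {a b : ℝ} (ha : a ∈ Ioo 0 (π / 4))
    {ν lam φ θ : ℝ → ℝ} (hν : IsOtsukiGeodesic a ν lam)
    {N : ℝ → ℝ → EuclideanSpace ℝ (Fin 4)} (hN : IsUnitNormalField (otsukiImmersion ν lam) N)
    (hφ : IsBipolarGeodesic b φ θ)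
    (hJ : range (fun x : ℝ × ℝ => equatorInclusion (bipolarImmersion φ θ x.1 x.2)) =
      bipolarSurface (otsukiImmersion ν lam) N) :
    cos b ^ 2 = 2 * (sin a * cos a) := by
  have hk : 0 < sin a * cos a :=
    mul_pos (hν.apply_zero ▸ hν.sin_pos 0) (hν.apply_zero ▸ hν.cos_pos 0)
  have h5 : ∀ α t, equatorInclusion (bipolarImmersion φ θ α t) 5 = sin (φ t) := fun _ _ => rfl
  -- Both sides are the maximum of the squared `e₃∧e₄`-coordinate. With `x = sin² ν` and `k = sin a
  -- cos a`, the inequality `x + k²/x ≥ 2k` gives one direction, and the point `x = k` the other.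
  suffices sin b ^ 2 = 1 - 2 * (sin a * cos a) by linarith [sin_sq_add_cos_sq b]
  apply le_antisymm
  · have h1 : equatorInclusion (bipolarImmersion φ θ 0 0) ∈
        bipolarSurface (otsukiImmersion ν lam) N := hJ ▸ ⟨(0, 0), rfl⟩
    obtain ⟨⟨α, t⟩, h2⟩ := h1
    have h3 := hν.wedge_five_sq hN α t
    simp only at h2
    rw [h2, h5, hφ.apply_zero] at h3
    rw [h3]
    have hs := hν.sin_pos t
    have h4 : sin (ν t) ^ 2 + (sin a * cos a) ^ 2 / sin (ν t) ^ 2 - 2 * (sin a * cos a) =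
        (sin (ν t) ^ 2 - sin a * cos a) ^ 2 / sin (ν t) ^ 2 := by
      field_simp
      ring
    have h6 : 0 ≤ (sin (ν t) ^ 2 - sin a * cos a) ^ 2 / sin (ν t) ^ 2 := by positivity
    linarith
  · obtain ⟨s, hs⟩ := hν.exists_sin_sq_eq ha
    have h1 : wedge (otsukiImmersion ν lam 0 s) (N 0 s) ∈
        range (fun x : ℝ × ℝ => equatorInclusion (bipolarImmersion φ θ x.1 x.2)) :=
      hJ ▸ ⟨(0, s), rfl⟩
    obtain ⟨⟨α, t⟩, h2⟩ := h1
    have h3 := hν.wedge_five_sq hN 0 s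
    simp only at h2
    rw [← h2, h5, hs] at h3
    have h4 : (sin a * cos a) ^ 2 / (sin a * cos a) = sin a * cos a := by
      field_simp
    have h6 : sin (φ t) ^ 2 ≤ sin b ^ 2 := by
      have h7 := hφ.cos_b_pos
      have h8 : cos b ≤ cos (φ t) := by
        rcases (hφ.mem_Icc t).1.eq_or_lt with h | h
        · rw [← h]
        rcases (hφ.mem_Icc t).2.eq_or_lt with h' | h'
        · rw [h', cos_neg]
        exact (hφ.cos_b_lt ⟨h, h'⟩).le
      have := pow_le_pow_left₀ h7.le h8 2
      linarith [sin_sq_add_cos_sq b, sin_sq_add_cos_sq (φ t)]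
    linarith

/-! ### Half periods, and `Ξ(b)` as a gain of longitude. -/

/-- Change of variables in an integral by a strictly monotone function, without integrability
hypotheses. -/
theorem integral_eq_integral_deriv_mul_of_strictMonoOn {f f' : ℝ → ℝ} {r s : ℝ} (hrs : r ≤ s)
    (hc : ContinuousOn f (Icc r s)) (hm : StrictMonoOn f (Icc r s))
    (hd : ∀ t ∈ Ioo r s, HasDerivAt f (f' t) t) (hf' : ∀ t ∈ Ioo r s, 0 ≤ f' t) (g : ℝ → ℝ) :
    ∫ u in f r..f s, g u = ∫ t in r..s, f' t * g (f t) := by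
  have hle : f r ≤ f s := hm.monotoneOn ⟨le_rfl, hrs⟩ ⟨hrs, le_rfl⟩ hrs
  have himg : f '' Ioo r s = Ioo (f r) (f s) := by
    refine Subset.antisymm ?_ (intermediate_value_Ioo hrs hc)
    rintro _ ⟨t, ht, rfl⟩
    exact ⟨hm ⟨le_rfl, hrs⟩ (Ioo_subset_Icc_self ht) ht.1,
      hm (Ioo_subset_Icc_self ht) ⟨hrs, le_rfl⟩ ht.2⟩
  -- Only open intervals matter: in the applications the integrand is singular at turning points,
  -- which are endpoints.
  rw [intervalIntegral.integral_of_le hle, intervalIntegral.integral_of_le hrs,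
    MeasureTheory.integral_Ioc_eq_integral_Ioo, MeasureTheory.integral_Ioc_eq_integral_Ioo, ← himg,
    MeasureTheory.integral_image_eq_integral_abs_deriv_smul measurableSet_Ioo
      (fun t ht => (hd t ht).hasDerivWithinAt) (hm.injOn.mono Ioo_subset_Icc_self)]
  refine MeasureTheory.setIntegral_congr_fun measurableSet_Ioo fun t ht => ?_
  simp only [smul_eq_mul, abs_of_nonneg (hf' t ht)]

/-- `τ` is the time that the latitude takes to grow from its minimum `b` to its maximum `-b`. -/
structure IsHalfPeriod (b : ℝ) (φ : ℝ → ℝ) (τ : ℝ) : Prop where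
  pos : 0 < τ
  deriv_zero : deriv φ 0 = 0
  deriv_self : deriv φ τ = 0
  apply_self : φ τ = -b
  deriv_pos : ∀ t ∈ Ioo 0 τ, 0 < deriv φ t
  strictMonoOn : StrictMonoOn φ (Icc 0 τ)

namespace IsBipolarGeodesic

variable {b τ : ℝ} {φ θ : ℝ → ℝ}

theorem exists_isHalfPeriod (h : IsBipolarGeodesic b φ θ) (hb : b < 0) :
    ∃ τ, IsHalfPeriod b φ τ := by
  obtain ⟨τ, h1, h2, h3, h4, h5, h6⟩ := h.exists_half_period hb
  exact ⟨τ, h1, h2, h3, h4, h5, h6⟩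

/-- Time reversal preserves the autonomous equation, and the velocity vanishes at time `0`. -/
theorem fst_neg (h : IsBipolarGeodesic b φ θ) (hτ : IsHalfPeriod b φ τ) (t : ℝ) :
    φ (-t) = φ t := by
  obtain ⟨K, hK⟩ := h.exists_lipschitzOnWith_accel
  have hu := second_order_ODE_unique hK (y := fun t => φ (-t)) (y' := fun t => -deriv φ (-t))
    (z := φ) (z' := deriv φ) (t₀ := 0) (fun t => ?_) (fun t => ?_) h.geodesic.hasDerivAt_fst
    h.hasDerivAt_deriv_fst (fun t => h.mem_Icc _) h.mem_Icc (by simp)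
    (by simp [hτ.deriv_zero])
  · exact congrFun hu t
  · exact ((h.geodesic.hasDerivAt_fst (-t)).scomp t (hasDerivAt_neg t)).congr_deriv (by simp)
  · exact ((h.hasDerivAt_deriv_fst (-t)).scomp t (hasDerivAt_neg t)).neg.congr_deriv (by simp)

/-- The acceleration is odd, so `-φ(t + τ)` solves the same equation; at time `0` it too has
position `b` and velocity `0`. -/
theorem fst_add_half_period (h : IsBipolarGeodesic b φ θ) (hτ : IsHalfPeriod b φ τ) (t : ℝ) :
    φ (t + τ) = -φ t := by
  obtain ⟨K, hK⟩ := h.exists_lipschitzOnWith_accel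
  have hu := second_order_ODE_unique hK (y := fun t => -φ (t + τ))
    (y' := fun t => -deriv φ (t + τ)) (z := φ) (z' := deriv φ) (t₀ := 0) (fun t => ?_)
    (fun t => ?_) h.geodesic.hasDerivAt_fst h.hasDerivAt_deriv_fst (fun t => ?_) h.mem_Icc
    (by simp [hτ.apply_self, h.apply_zero]) (by simp [hτ.deriv_zero, hτ.deriv_self])
  · rw [← congrFun hu t, neg_neg]
  · exact ((h.geodesic.hasDerivAt_fst (t + τ)).comp_add_const t τ).neg
  · rw [accel_neg]
    exact ((h.hasDerivAt_deriv_fst (t + τ)).comp_add_const t τ).neg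
  · have := h.mem_Icc (t + τ)
    exact ⟨by linarith [this.2], by linarith [this.1]⟩

theorem deriv_fst_add_half_period (h : IsBipolarGeodesic b φ θ) (hτ : IsHalfPeriod b φ τ) (t : ℝ) :
    deriv φ (t + τ) = -deriv φ t := by
  rw [← deriv_comp_add_const, ← deriv.neg]
  congr 1
  funext t
  exact h.fst_add_half_period hτ t

theorem continuous_fst (h : IsBipolarGeodesic b φ θ) : Continuous φ :=
  h.geodesic.contDiff_fst.continuous

theorem continuous_longitudinal_speed (h : IsBipolarGeodesic b φ θ) :
    Continuous fun t => cos b ^ 2 / (2 * π * cos (φ t) ^ 4) := by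
  have := h.continuous_fst
  refine Continuous.div (by fun_prop) (by fun_prop) fun t => ?_
  have := h.cos_pos t
  positivity

/-- Using time as the variable replaces the singular integrand by the continuous longitudinal speed.
-/
theorem Xi_eq_integral (h : IsBipolarGeodesic b φ θ) (hτ : IsHalfPeriod b φ τ) :
    Xi b = ∫ t in (0)..τ, cos b ^ 2 / (2 * π * cos (φ t) ^ 4) := by
  have hcv := integral_eq_integral_deriv_mul_of_strictMonoOn hτ.pos.le
    h.continuous_fst.continuousOn hτ.strictMonoOn (fun t _ => h.geodesic.hasDerivAt_fst t)
    (fun t ht => (hτ.deriv_pos t ht).le) (fun s => 1 / (cos s * √(cos s ^ 4 - cos b ^ 4)))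
  rw [h.apply_zero, hτ.apply_self] at hcv
  rw [Xi, hcv, ← intervalIntegral.integral_const_mul,
    intervalIntegral.integral_of_le hτ.pos.le, intervalIntegral.integral_of_le hτ.pos.le,
    MeasureTheory.integral_Ioc_eq_integral_Ioo, MeasureTheory.integral_Ioc_eq_integral_Ioo]
  refine MeasureTheory.setIntegral_congr_fun measurableSet_Ioo fun t ht => ?_
  have h1 := hτ.deriv_pos t ht
  have h2 := h.cos_pos t
  have h3 : √(cos (φ t) ^ 4 - cos b ^ 4) = 2 * π * cos (φ t) ^ 3 * deriv φ t := by
    rw [sqrt_eq_iff_mul_self_eq_of_pos (by positivity)]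
    have := h.deriv_fst_sq t
    field_simp at this
    linarith
  simp only [h3]
  field_simp

/-! ### The substitution proving `Ω(a) = Ξ(b)`. -/

/-- An auxiliary function of the latitude and its velocity: the squared sine of the latitude of the
point of the Otsuki geodesic that corresponds to a point of the bipolar geodesic. -/
noncomputable def otsukiSinSq (φ : ℝ → ℝ) (t : ℝ) : ℝ :=
  (cos (φ t) ^ 2 - 2 * π * cos (φ t) ^ 3 * deriv φ t) / 2

/-- With `k = cos² b / 2` this is `sin² φ = 1 - x - k²/x`, the formula of `wedge_five_sq`. The term
in `φ'` selects the root of this quadratic equation in `x`, and keeps `x` differentiable through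
turning points. -/
theorem otsukiSinSq_mul (h : IsBipolarGeodesic b φ θ) (t : ℝ) :
    otsukiSinSq φ t * (cos (φ t) ^ 2 - otsukiSinSq φ t) = (cos b ^ 2 / 2) ^ 2 := by
  have h1 := h.deriv_fst_sq t
  have h2 := h.cos_pos t
  rw [otsukiSinSq]
  field_simp at h1
  linear_combination (-(1 : ℝ) / 4) * h1

theorem otsukiSinSq_pos (h : IsBipolarGeodesic b φ θ) (t : ℝ) : 0 < otsukiSinSq φ t := by
  have h1 := h.otsukiSinSq_mul t
  have h2 := h.cos_pos t
  have h3 := h.cos_b_pos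
  have h4 : 0 < otsukiSinSq φ t * (cos (φ t) ^ 2 - otsukiSinSq φ t) := by
    rw [h1]; positivity
  rcases mul_pos_iff.1 h4 with h5 | h5
  · exact h5.1
  · have : 0 < cos (φ t) ^ 2 := by positivity
    linarith

theorem otsukiSinSq_lt (h : IsBipolarGeodesic b φ θ) (t : ℝ) :
    otsukiSinSq φ t < cos (φ t) ^ 2 := by
  have h1 := h.otsukiSinSq_mul t
  have h3 := h.cos_b_pos
  have h4 : 0 < otsukiSinSq φ t * (cos (φ t) ^ 2 - otsukiSinSq φ t) := by
    rw [h1]; positivity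
  linarith [pos_of_mul_pos_right h4 (h.otsukiSinSq_pos t).le]

theorem otsukiSinSq_lt_one (h : IsBipolarGeodesic b φ θ) (t : ℝ) : otsukiSinSq φ t < 1 :=
  (h.otsukiSinSq_lt t).trans_le (cos_sq_le_one _)

/-- The derivative has the sign of `sin φ`, so `x` is monotone between consecutive zeroes of `φ`. -/
theorem hasDerivAt_otsukiSinSq (h : IsBipolarGeodesic b φ θ) (t : ℝ) :
    HasDerivAt (otsukiSinSq φ) (sin (φ t) * otsukiSinSq φ t / (π * cos (φ t) ^ 2)) t := by
  have hφ := h.geodesic.hasDerivAt_fst t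
  have h2 := h.cos_pos t
  have h3 := h.deriv_fst_sq t
  have h1 : HasDerivAt (otsukiSinSq φ) _ t := ((hφ.cos.fun_pow 2).fun_sub
    (((hφ.cos.fun_pow 3).const_mul (2 * π)).fun_mul (h.hasDerivAt_deriv_fst t))).div_const 2
  refine h1.congr_deriv ?_
  rw [accel, otsukiSinSq]
  have h4 : 4 * π ^ 2 * cos (φ t) ^ 6 * deriv φ t ^ 2 = cos (φ t) ^ 4 - cos b ^ 4 := by
    rw [h3]; field_simp
  push_cast
  field_simp
  linear_combination 6 * sin (φ t) * h4

theorem continuous_otsukiSinSq (h : IsBipolarGeodesic b φ θ) : Continuous (otsukiSinSq φ) :=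
  continuous_iff_continuousAt.2 fun t => (h.hasDerivAt_otsukiSinSq t).continuousAt

/-- The integrands of `Ξ(b)` and `Ω(a)`, both expressed in time, differ by an exact derivative whose
primitive vanishes wherever `φ = 0`. -/
theorem hasDerivAt_arctan_otsukiSinSq (h : IsBipolarGeodesic b φ θ) (t : ℝ) :
    HasDerivAt (fun t => arctan (otsukiSinSq φ t * sin (φ t) / (cos b ^ 2 / 2)))
      (cos b ^ 2 / (2 * π * cos (φ t) ^ 4) -
        cos b ^ 2 / 2 / (2 * π * cos (φ t) ^ 2 * (1 - otsukiSinSq φ t))) t := by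
  have hφ := h.geodesic.hasDerivAt_fst t
  have h1 := (((h.hasDerivAt_otsukiSinSq t).fun_mul hφ.sin).div_const (cos b ^ 2 / 2)).arctan
  refine h1.congr_deriv ?_
  have hb := h.cos_b_pos
  have hc := h.cos_pos t
  have hx := h.otsukiSinSq_pos t
  have hx1 : 0 < 1 - otsukiSinSq φ t := by linarith [h.otsukiSinSq_lt_one t]
  have hxc : 0 < cos (φ t) ^ 2 - otsukiSinSq φ t := by linarith [h.otsukiSinSq_lt t]
  have hk := h.otsukiSinSq_mul t
  have hd : cos (φ t) * deriv φ t =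
      (cos (φ t) ^ 2 - 2 * otsukiSinSq φ t) / (2 * π * cos (φ t) ^ 2) := by
    rw [otsukiSinSq]
    field_simp
    ring
  have hs := sin_sq_add_cos_sq (φ t)
  have hb2 : 0 < cos b ^ 2 / 2 := by positivity
  obtain ⟨k, hkk⟩ : ∃ k, k = cos b ^ 2 / 2 := ⟨_, rfl⟩
  have hkk' : cos b ^ 2 = 2 * k := by rw [hkk]; ring
  rw [← hkk] at hk hb2 ⊢
  rw [hkk', hd]
  set x := otsukiSinSq φ t
  set s := sin (φ t)
  set c := cos (φ t)
  have e1 : 1 + (x * s / k) ^ 2 = c ^ 2 * (1 - x) / (c ^ 2 - x) := by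
    have : (x * s / k) ^ 2 = (x * s) ^ 2 / (x * (c ^ 2 - x)) := by rw [hk, div_pow]
    rw [this]
    field_simp
    linear_combination x * hs
  have e2 : s * x / (π * c ^ 2) * s + x * ((c ^ 2 - 2 * x) / (2 * π * c ^ 2)) =
      x * (2 - c ^ 2 - 2 * x) / (2 * π * c ^ 2) := by
    field_simp
    linear_combination 2 * hs
  rw [e1, e2]
  field_simp
  linear_combination (2 - c ^ 2 - 2 * x) * hk

/-- On the equator the quadratic has roots `sin² a` and `cos² a`; an upward crossing selects the one
below `1/2`. -/
theorem otsukiSinSq_eq_of_eq_zero (h : IsBipolarGeodesic b φ θ) {a : ℝ} (ha : a ∈ Ioo 0 (π / 4))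
    (hab : cos b ^ 2 = 2 * (sin a * cos a)) {t : ℝ} (ht : φ t = 0) (hd : 0 < deriv φ t) :
    otsukiSinSq φ t = sin a ^ 2 := by
  have h1 := h.otsukiSinSq_mul t
  rw [ht, cos_zero, hab] at h1
  have h2 : otsukiSinSq φ t < 1 / 2 := by
    rw [otsukiSinSq, ht, cos_zero]
    have := mul_pos pi_pos hd
    linarith
  have h3 : sin a ^ 2 < 1 / 2 := by
    have := cos_pos_of_mem_Ioo (x := 2 * a) ⟨by linarith [ha.1, pi_pos], by linarith [ha.2]⟩
    rw [cos_two_mul, cos_sq'] at this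
    linarith
  have h4 : (otsukiSinSq φ t - sin a ^ 2) * (otsukiSinSq φ t + sin a ^ 2 - 1) = 0 := by
    linear_combination -h1 - sin a ^ 2 * sin_sq_add_cos_sq a
  rcases mul_eq_zero.1 h4 with h5 | h5 <;> linarith

theorem Omega_eq_Xi (h : IsBipolarGeodesic b φ θ) (hb : b < 0) {a : ℝ} (ha : a ∈ Ioo 0 (π / 4))
    (hab : cos b ^ 2 = 2 * (sin a * cos a)) : Omega a = Xi b := by
  obtain ⟨τ, hτ⟩ := h.exists_isHalfPeriod hb
  have hpi := pi_pos
  have hsa : 0 < sin a := sin_pos_of_pos_of_lt_pi ha.1 (by linarith [ha.2])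
  have hca : 0 < cos a := cos_pos_of_mem_Ioo ⟨by linarith [ha.1], by linarith [ha.2]⟩
  obtain ⟨r, hr, hr0⟩ : ∃ r ∈ Ioo 0 τ, φ r = 0 :=
    intermediate_value_Ioo hτ.pos.le h.continuous_fst.continuousOn
      ⟨by rw [h.apply_zero]; exact hb, by rw [hτ.apply_self]; linarith⟩
  have hrd := hτ.deriv_pos r hr
  have hrτ : φ (r + τ) = 0 := by rw [h.fst_add_half_period hτ, hr0, neg_zero]
  have hφpos : ∀ t ∈ Ioo r (r + τ), 0 < φ t := by
    intro t ht
    rcases le_total t τ with h1 | h1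
    · rw [← hr0]
      exact hτ.strictMonoOn (Ioo_subset_Icc_self hr) ⟨(hr.1.trans ht.1).le, h1⟩ ht.1
    · have h2 := h.fst_add_half_period hτ (t - τ)
      rw [sub_add_cancel] at h2
      have h3 : φ (t - τ) < φ r := hτ.strictMonoOn ⟨by linarith, by linarith [ht.2, hr.2]⟩
        (Ioo_subset_Icc_self hr) (by linarith [ht.2])
      rw [h2]
      linarith
  have hsin : ∀ t ∈ Ioo r (r + τ), 0 < sin (φ t) := fun t ht =>
    sin_pos_of_pos_of_lt_pi (hφpos t ht) (by linarith [(h.mem_Ioo t).2])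
  have hx0 := h.otsukiSinSq_eq_of_eq_zero ha hab hr0 hrd
  have hx1 : otsukiSinSq φ (r + τ) = cos a ^ 2 := by
    have e1 : otsukiSinSq φ (r + τ) = 1 - otsukiSinSq φ r := by
      simp only [otsukiSinSq, hrτ, hr0, h.deriv_fst_add_half_period hτ, cos_zero]
      ring
    rw [e1, hx0, cos_sq']
  have hle : r ≤ r + τ := by linarith [hτ.pos]
  -- the substitution `sin² ν = x`
  have hxm : StrictMonoOn (otsukiSinSq φ) (Icc r (r + τ)) := by
    refine strictMonoOn_of_deriv_pos (convex_Icc _ _) h.continuous_otsukiSinSq.continuousOn ?_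
    intro t ht
    rw [interior_Icc] at ht
    rw [(h.hasDerivAt_otsukiSinSq t).deriv]
    have h1 := hsin t ht
    have h2 := h.otsukiSinSq_pos t
    have h3 := h.cos_pos t
    positivity
  have hsq1 : ∀ t, √(otsukiSinSq φ t) < 1 := fun t => by
    rw [sqrt_lt' one_pos]
    linarith [h.otsukiSinSq_lt_one t]
  set n : ℝ → ℝ := fun t => arcsin (√(otsukiSinSq φ t)) with hn
  have hnm : StrictMonoOn n (Icc r (r + τ)) := by
    intro s hs t ht hst
    refine strictMonoOn_arcsin ⟨by linarith [sqrt_nonneg (otsukiSinSq φ s)], (hsq1 s).le⟩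
      ⟨by linarith [sqrt_nonneg (otsukiSinSq φ t)], (hsq1 t).le⟩ ?_
    exact sqrt_lt_sqrt (h.otsukiSinSq_pos s).le (hxm hs ht hst)
  have hnc : Continuous n := by
    have := h.continuous_otsukiSinSq
    fun_prop
  have hnd : ∀ t, HasDerivAt n (1 / √(1 - otsukiSinSq φ t) *
      (sin (φ t) * otsukiSinSq φ t / (π * cos (φ t) ^ 2) / (2 * √(otsukiSinSq φ t)))) t := by
    intro t
    have h1 := (h.hasDerivAt_otsukiSinSq t).sqrt (h.otsukiSinSq_pos t).ne'
    have h2 := (hasDerivAt_arcsin (x := √(otsukiSinSq φ t))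
      (by linarith [sqrt_nonneg (otsukiSinSq φ t)]) (hsq1 t).ne).comp t h1
    rwa [sq_sqrt (h.otsukiSinSq_pos t).le] at h2
  have hn0 : n r = a := by
    rw [hn]
    simp only [hx0]
    rw [sqrt_sq hsa.le, arcsin_sin (by linarith [ha.1]) (by linarith [ha.2])]
  have hn1 : n (r + τ) = π / 2 - a := by
    rw [hn]
    simp only [hx1]
    rw [sqrt_sq hca.le, ← sin_pi_div_two_sub, arcsin_sin (by linarith [ha.2]) (by linarith [ha.1])]
  have hΩ : Omega a = ∫ t in r..(r + τ),
      cos b ^ 2 / 2 / (2 * π * cos (φ t) ^ 2 * (1 - otsukiSinSq φ t)) := by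
    have hcv := integral_eq_integral_deriv_mul_of_strictMonoOn hle hnc.continuousOn hnm
      (fun t _ => hnd t) (fun t ht => ?_)
      (fun s => 1 / (cos s * √(sin s ^ 2 * cos s ^ 2 - sin a ^ 2 * cos a ^ 2)))
    · rw [hn0, hn1] at hcv
      rw [Omega, hcv, ← intervalIntegral.integral_const_mul]
      rw [intervalIntegral.integral_of_le hle, intervalIntegral.integral_of_le hle,
        MeasureTheory.integral_Ioc_eq_integral_Ioo, MeasureTheory.integral_Ioc_eq_integral_Ioo]
      refine MeasureTheory.setIntegral_congr_fun measurableSet_Ioo fun t ht => ?_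
      have h1 := hsin t ht
      have h2 := h.otsukiSinSq_pos t
      have h3 := h.cos_pos t
      have h4 : 0 < 1 - otsukiSinSq φ t := by linarith [h.otsukiSinSq_lt_one t]
      have h5 := sq_sqrt h2.le
      have h6 := sq_sqrt h4.le
      have e1 : sin (n t) = √(otsukiSinSq φ t) :=
        sin_arcsin (by linarith [sqrt_nonneg (otsukiSinSq φ t)]) (hsq1 t).le
      have e2 : cos (n t) = √(1 - otsukiSinSq φ t) := by
        rw [hn, cos_arcsin, h5]
      -- Here `x(1 - x) - k² = x(1 - x) - x(cos² φ - x) = x sin² φ`.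
      have e3 : √(sin (n t) ^ 2 * cos (n t) ^ 2 - sin a ^ 2 * cos a ^ 2) =
          √(otsukiSinSq φ t) * sin (φ t) := by
        rw [sqrt_eq_iff_mul_self_eq_of_pos (by positivity), e1, e2, h5, h6]
        have h7 := h.otsukiSinSq_mul t
        rw [hab] at h7
        linear_combination sin (φ t) ^ 2 * h5 - h7 +
          otsukiSinSq φ t * sin_sq_add_cos_sq (φ t)
      have e4 : cos b ^ 2 / 2 = sin a * cos a := by rw [hab]; ring
      simp only [e3]
      rw [e2, e4]
      field_simp
      rw [h5, h6]
      field_simp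
    · have h1 := hsin t ht
      have h2 := h.otsukiSinSq_pos t
      have h3 := h.cos_pos t
      positivity
  have hper : Function.Periodic (fun t => cos b ^ 2 / (2 * π * cos (φ t) ^ 4)) τ := fun t => by
    simp only [h.fst_add_half_period hτ, cos_neg]
  have hc2 : Continuous fun t =>
      cos b ^ 2 / 2 / (2 * π * cos (φ t) ^ 2 * (1 - otsukiSinSq φ t)) := by
    have h1 := h.continuous_otsukiSinSq
    have h2 := h.continuous_fst
    refine Continuous.div (by fun_prop) (by fun_prop) fun t => ?_
    have h3 := h.cos_pos t
    have h4 : 0 < 1 - otsukiSinSq φ t := by linarith [h.otsukiSinSq_lt_one t]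
    positivity
  have hi1 := h.continuous_longitudinal_speed.intervalIntegrable (μ := MeasureTheory.volume)
    r (r + τ)
  have hi2 := hc2.intervalIntegrable (μ := MeasureTheory.volume) r (r + τ)
  have hftc := intervalIntegral.integral_eq_sub_of_hasDerivAt
    (fun t _ => h.hasDerivAt_arctan_otsukiSinSq t) (hi1.sub hi2)
  rw [intervalIntegral.integral_sub hi1 hi2, hr0, hrτ] at hftc
  rw [hΩ, h.Xi_eq_integral hτ]
  -- `Ξ(b)` is an integral over `[0, τ]`, while the substitution runs from one equator crossing to
  -- the next; the integrand is `τ`-periodic.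
  have h0 := hper.intervalIntegral_add_eq 0 r
  rw [zero_add] at h0
  rw [h0]
  simp only [sin_zero, mul_zero, zero_div, sub_self] at hftc
  linarith

end IsBipolarGeodesic

/-! ### Periods, zeroes and coincidences of the closed curve. -/

/-- A strictly increasing continuous function preserves the number of points of a set in an
interval. -/
theorem StrictMono.ncard_preimage_inter_Ico {f : ℝ → ℝ} (hm : StrictMono f) (hc : Continuous f)
    {r s : ℝ} (hrs : r ≤ s) (Z : Set ℝ) :
    {t ∈ Ico r s | f t ∈ Z}.ncard = (Z ∩ Ico (f r) (f s)).ncard := by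
  have h : Z ∩ Ico (f r) (f s) = f '' {t ∈ Ico r s | f t ∈ Z} := by
    ext u
    constructor
    · rintro ⟨hu, hu'⟩
      obtain ⟨t, ht, rfl⟩ := intermediate_value_Ico hrs hc.continuousOn hu'
      exact ⟨t, ⟨ht, hu⟩, rfl⟩
    · rintro ⟨t, ⟨ht, hu⟩, rfl⟩
      exact ⟨hu, hm.monotone ht.1, hm ht.2⟩
  rw [h, ncard_image_of_injective _ hm.injective]

theorem AddCircle.coe_eq_coe_iff_exists {p x y : ℝ} :
    (x : AddCircle p) = y ↔ ∃ n : ℤ, x = y + n * p := by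
  rw [← sub_eq_zero, ← AddCircle.coe_sub, AddCircle.coe_eq_zero_iff]
  refine exists_congr fun n => ?_
  rw [zsmul_eq_mul]
  constructor <;> intro h <;> linarith

namespace IsBipolarGeodesic

variable {b τ : ℝ} {φ θ : ℝ → ℝ}

theorem fst_add_int_mul (h : IsBipolarGeodesic b φ θ) (hτ : IsHalfPeriod b φ τ) (t : ℝ) (j : ℤ) :
    φ (t + j * (2 * τ)) = φ t := by
  have hp : Function.Periodic φ (2 * τ) := fun t => by
    rw [two_mul, ← add_assoc, h.fst_add_half_period hτ, h.fst_add_half_period hτ, neg_neg]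
  exact hp.int_mul j t

theorem exists_mem_Icc (hτ : IsHalfPeriod b φ τ) (t : ℝ) :
    ∃ r ∈ Icc 0 τ, ∃ j : ℤ, t = r + j * (2 * τ) ∨ t = -r + j * (2 * τ) := by
  have hτ0 := hτ.pos
  obtain ⟨j, hj, -⟩ := existsUnique_sub_zsmul_mem_Ico (by linarith : 0 < 2 * τ) t 0
  simp only [zsmul_eq_mul, zero_add] at hj
  rcases le_total (t - j * (2 * τ)) τ with h1 | h1
  · exact ⟨t - j * (2 * τ), ⟨hj.1, h1⟩, j, Or.inl (by ring)⟩
  · refine ⟨2 * τ - (t - j * (2 * τ)), ⟨by linarith [hj.2], by linarith⟩, j + 1, Or.inr ?_⟩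
    push_cast
    ring

/-- Evenness and the period `2τ` fold both times into `[0, τ]`, where the latitude is injective. -/
theorem exists_of_fst_eq (h : IsBipolarGeodesic b φ θ) (hτ : IsHalfPeriod b φ τ) {s t : ℝ}
    (hst : φ s = φ t) : ∃ j : ℤ, s = t + j * (2 * τ) ∨ s = -t + j * (2 * τ) := by
  have hred : ∀ t r : ℝ, ∀ j : ℤ, (t = r + j * (2 * τ) ∨ t = -r + j * (2 * τ)) → φ t = φ r := by
    rintro t r j (rfl | rfl)
    · exact h.fst_add_int_mul hτ r j
    · rw [h.fst_add_int_mul hτ, h.fst_neg hτ]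
  obtain ⟨r, hr, j, hj⟩ := exists_mem_Icc hτ s
  obtain ⟨r', hr', j', hj'⟩ := exists_mem_Icc hτ t
  have hrr : r = r' := hτ.strictMonoOn.injOn hr hr' (by
    rw [← hred s r j hj, ← hred t r' j' hj', hst])
  subst hrr
  rcases hj with rfl | rfl <;> rcases hj' with rfl | rfl
  · exact ⟨j - j', Or.inl (by push_cast; ring)⟩
  · exact ⟨j + j', Or.inr (by push_cast; ring)⟩
  · exact ⟨j + j', Or.inr (by push_cast; ring)⟩
  · exact ⟨j - j', Or.inl (by push_cast; ring)⟩

theorem sin_fst_eq_zero_iff (h : IsBipolarGeodesic b φ θ) (t : ℝ) : sin (φ t) = 0 ↔ φ t = 0 := by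
  have := h.mem_Ioo t
  exact sin_eq_zero_iff_of_lt_of_lt (by linarith [this.1, pi_pos]) (by linarith [this.2, pi_pos])

/-- The latitude crosses `0` once while rising on `(0, τ)`, and every later half period repeats this
up to sign. -/
theorem ncard_sin_fst_eq_zero (h : IsBipolarGeodesic b φ θ) (hb : b < 0)
    (hτ : IsHalfPeriod b φ τ) (n : ℕ) : {t ∈ Ico 0 (n * τ) | sin (φ t) = 0}.ncard = n := by
  have h0 : {t ∈ Ico 0 (n * τ) | sin (φ t) = 0} = {t | φ t = 0} ∩ Ico 0 (0 + n * τ) := by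
    ext t
    rw [zero_add]
    exact ⟨fun ht => ⟨(h.sin_fst_eq_zero_iff t).1 ht.2, ht.1⟩,
      fun ht => ⟨ht.2, (h.sin_fst_eq_zero_iff t).2 ht.1⟩⟩
  rw [h0]
  refine ncard_inter_Ico_of_existsUnique hτ.pos (fun j => ?_) n
  have hj : ∀ t, φ (t + j * τ) = 0 ↔ φ t = 0 := by
    induction j with
    | zero => simp
    | succ j ih =>
      intro t
      rw [← ih t]
      push_cast
      rw [add_mul, one_mul, ← add_assoc, h.fst_add_half_period hτ, neg_eq_zero]
  obtain ⟨r, hr, hr0⟩ : ∃ r ∈ Ioo 0 τ, φ r = 0 :=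
    intermediate_value_Ioo hτ.pos.le h.continuous_fst.continuousOn
      ⟨by rw [h.apply_zero]; exact hb, by rw [hτ.apply_self]; linarith⟩
  refine ⟨r + j * τ, ⟨(hj r).2 hr0, by linarith [hr.1], by linarith [hr.2]⟩, ?_⟩
  rintro s ⟨hs, h1, h2⟩
  have h3 : φ (s - j * τ) = 0 := (hj _).1 (by simpa using hs)
  have h4 := hτ.strictMonoOn.injOn (x₁ := s - j * τ) (x₂ := r) ⟨by linarith, by linarith⟩
    (Ioo_subset_Icc_self hr) (by rw [h3, hr0])
  linarith

/-- The longitude up to its sign `ε`: it increases by `Ξ(b)` in each half period. -/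
structure IsLongitudeSign (b : ℝ) (φ θ : ℝ → ℝ) (ε : ℝ) : Prop where
  eq_one_or : ε = 1 ∨ ε = -1
  hasDerivAt : ∀ t, HasDerivAt θ (ε * (cos b ^ 2 / (2 * π * cos (φ t) ^ 4))) t

variable {ε : ℝ}

theorem strictMono_sign_mul (h : IsBipolarGeodesic b φ θ) (hε : IsLongitudeSign b φ θ ε) :
    StrictMono fun t => ε * θ t := by
  refine strictMono_of_deriv_pos fun t => ?_
  rw [((hε.hasDerivAt t).const_mul ε).deriv, ← mul_assoc]
  have h1 : ε * ε = 1 := by rcases hε.eq_one_or with rfl | rfl <;> norm_num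
  have h2 := h.cos_pos t
  have h3 := h.cos_b_pos
  rw [h1]
  positivity

theorem injective_snd (h : IsBipolarGeodesic b φ θ) (hε : IsLongitudeSign b φ θ ε) :
    Function.Injective θ := fun s t hst =>
  (h.strictMono_sign_mul hε).injective (by simp only [hst])

theorem continuous_snd (h : IsBipolarGeodesic b φ θ) : Continuous θ :=
  h.geodesic.contDiff_snd.continuous

theorem snd_neg (h : IsBipolarGeodesic b φ θ) (hτ : IsHalfPeriod b φ τ)
    (hε : IsLongitudeSign b φ θ ε) (t : ℝ) : θ (-t) = 2 * θ 0 - θ t := by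
  have hd : ∀ t, HasDerivAt (fun t => θ (-t) + θ t) 0 t := by
    intro t
    refine (((hε.hasDerivAt (-t)).scomp t (hasDerivAt_neg t)).add (hε.hasDerivAt t)).congr_deriv ?_
    rw [h.fst_neg hτ, smul_eq_mul]
    ring
  have := is_const_of_deriv_eq_zero (fun t => (hd t).differentiableAt) (fun t => (hd t).deriv) t 0
  simp only [neg_zero] at this
  linarith

/-- The longitudinal speed depends on `cos φ` only, hence is `τ`-periodic. -/
theorem snd_add_half_period (h : IsBipolarGeodesic b φ θ) (hτ : IsHalfPeriod b φ τ)
    (hε : IsLongitudeSign b φ θ ε) (t : ℝ) : θ (t + τ) = θ t + ε * Xi b := by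
  have hper : Function.Periodic (fun t => cos b ^ 2 / (2 * π * cos (φ t) ^ 4)) τ := fun t => by
    simp only [h.fst_add_half_period hτ, cos_neg]
  have h1 := intervalIntegral.integral_eq_sub_of_hasDerivAt (a := t) (b := t + τ)
    (fun t _ => hε.hasDerivAt t)
    ((h.continuous_longitudinal_speed.const_mul ε).intervalIntegrable _ _)
  have h2 := hper.intervalIntegral_add_eq 0 t
  rw [zero_add] at h2
  rw [intervalIntegral.integral_const_mul, ← h2, ← h.Xi_eq_integral hτ] at h1
  linarith

theorem snd_add_int_mul (h : IsBipolarGeodesic b φ θ) (hτ : IsHalfPeriod b φ τ)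
    (hε : IsLongitudeSign b φ θ ε) (t : ℝ) (j : ℤ) :
    θ (t + j * (2 * τ)) = θ t + j * (2 * (ε * Xi b)) := by
  -- Subtracting the linear drift makes the longitude periodic, which handles all integers `j` at
  -- once.
  have hp : Function.Periodic (fun t => θ t - t * (2 * (ε * Xi b)) / (2 * τ)) (2 * τ) := by
    intro t
    have hτ0 := hτ.pos
    simp only
    rw [two_mul τ, ← add_assoc, h.snd_add_half_period hτ hε, h.snd_add_half_period hτ hε]
    field_simp
    ring
  have h1 := hp.int_mul j t
  have hτ0 := hτ.pos
  have h2 : (t + j * (2 * τ)) * (2 * (ε * Xi b)) / (2 * τ) =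
      t * (2 * (ε * Xi b)) / (2 * τ) + j * (2 * (ε * Xi b)) := by field_simp
  rw [h2] at h1
  linarith

/-- Two points of the torus with the same image have the same latitude, and the angles are either
the same or differ by `π`. -/
theorem cos_sub_eq_of_bipolarImmersion_eq (h : IsBipolarGeodesic b φ θ) {α β s t : ℝ}
    (he : bipolarImmersion φ θ β s = bipolarImmersion φ θ α t) :
    φ s = φ t ∧ (cos (β - α) = 1 ∧ cos (θ s - θ t) = 1 ∨
      cos (β - α) = -1 ∧ cos (θ s - θ t) = -1) := by
  have e0 : cos β * cos (φ s) * sin (θ s) = cos α * cos (φ t) * sin (θ t) := congrArg (· 0) he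
  have e1 : sin β * cos (φ s) * sin (θ s) = sin α * cos (φ t) * sin (θ t) := congrArg (· 1) he
  have e2 : cos β * cos (φ s) * cos (θ s) = cos α * cos (φ t) * cos (θ t) := congrArg (· 2) he
  have e3 : sin β * cos (φ s) * cos (θ s) = sin α * cos (φ t) * cos (θ t) := congrArg (· 3) he
  have e4 : sin (φ s) = sin (φ t) := congrArg (· 4) he
  have hφ : φ s = φ t := injOn_sin (Ioo_subset_Icc_self (h.mem_Ioo s))
    (Ioo_subset_Icc_self (h.mem_Ioo t)) e4
  refine ⟨hφ, ?_⟩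
  rw [hφ] at e0 e1 e2 e3
  have hc := (h.cos_pos t).ne'
  have f0 : cos β * sin (θ s) = cos α * sin (θ t) := mul_left_cancel₀ hc (by linarith)
  have f1 : sin β * sin (θ s) = sin α * sin (θ t) := mul_left_cancel₀ hc (by linarith)
  have f2 : cos β * cos (θ s) = cos α * cos (θ t) := mul_left_cancel₀ hc (by linarith)
  have f3 : sin β * cos (θ s) = sin α * cos (θ t) := mul_left_cancel₀ hc (by linarith)
  -- The inner product of the equal unit tensors `(cos β, sin β) ⊗ (sin θ s, cos θ s)` and `(cos α,
  -- sin α) ⊗ (sin θ t, cos θ t)`. Neither factor exceeds `1` in absolute value, so both are `1` or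
  -- both are `-1`.
  have key : cos (β - α) * cos (θ s - θ t) = 1 := by
    rw [cos_sub, cos_sub]
    linear_combination cos α * sin (θ t) * f0 + sin α * sin (θ t) * f1 +
      cos α * cos (θ t) * f2 + sin α * cos (θ t) * f3 +
      (sin (θ t) ^ 2 + cos (θ t) ^ 2) * sin_sq_add_cos_sq α + sin_sq_add_cos_sq (θ t)
  have h1 : cos (β - α) ^ 2 = 1 := by
    have b1 := cos_sq_le_one (β - α)
    have b2 := cos_sq_le_one (θ s - θ t)
    have b3 : cos (β - α) ^ 2 * cos (θ s - θ t) ^ 2 = 1 := by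
      rw [← mul_pow, key, one_pow]
    nlinarith [sq_nonneg (cos (β - α))]
  rcases mul_self_eq_one_iff.1 ((sq _).symm.trans h1) with h2 | h2
  all_goals rw [h2] at key ⊢
  · left; exact ⟨rfl, by linarith⟩
  · right; exact ⟨rfl, by linarith⟩

end IsBipolarGeodesic

namespace IsBipolarGeodesic

variable {b τ ε : ℝ} {φ θ : ℝ → ℝ} {p q : ℕ}

theorem bipolarImmersion_eq (φ θ : ℝ → ℝ) {α β s t : ℝ} (hφ : φ s = φ t)
    (h0 : cos β * sin (θ s) = cos α * sin (θ t)) (h1 : sin β * sin (θ s) = sin α * sin (θ t))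
    (h2 : cos β * cos (θ s) = cos α * cos (θ t)) (h3 : sin β * cos (θ s) = sin α * cos (θ t)) :
    bipolarImmersion φ θ β s = bipolarImmersion φ θ α t := by
  ext i
  fin_cases i
  · change cos β * cos (φ s) * sin (θ s) = cos α * cos (φ t) * sin (θ t)
    rw [hφ, mul_right_comm, h0, mul_right_comm]
  · change sin β * cos (φ s) * sin (θ s) = sin α * cos (φ t) * sin (θ t)
    rw [hφ, mul_right_comm, h1, mul_right_comm]
  · change cos β * cos (φ s) * cos (θ s) = cos α * cos (φ t) * cos (θ t)
    rw [hφ, mul_right_comm, h2, mul_right_comm]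
  · change sin β * cos (φ s) * cos (θ s) = sin α * cos (φ t) * cos (θ t)
    rw [hφ, mul_right_comm, h3, mul_right_comm]
  · change sin (φ s) = sin (φ t)
    rw [hφ]

/-- `2q` half periods close the curve, when `Ξ(b) = pπ/q`. -/
theorem snd_add_period (h : IsBipolarGeodesic b φ θ) (hτ : IsHalfPeriod b φ τ)
    (hε : IsLongitudeSign b φ θ ε) (hq : 0 < q) (hΞ : Xi b = p / q * π) (t : ℝ) (n : ℤ) :
    θ (t + n * (2 * q * τ)) = θ t + ε * ((n * p : ℤ) * (2 * π)) := by
  have h1 := h.snd_add_int_mul hτ hε t (n * q)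
  have h2 : ((n * q : ℤ) : ℝ) * (2 * τ) = n * (2 * q * τ) := by push_cast; ring
  rw [h2, hΞ] at h1
  have hq' : (q : ℝ) ≠ 0 := by exact_mod_cast hq.ne'
  rw [h1]
  push_cast
  field_simp

theorem fst_add_period (h : IsBipolarGeodesic b φ θ) (hτ : IsHalfPeriod b φ τ) (t : ℝ) (n : ℤ) :
    φ (t + n * (2 * q * τ)) = φ t := by
  rw [← h.fst_add_int_mul hτ t (n * q)]
  congr 1
  push_cast
  ring

theorem IsLongitudeSign.exists_int_eq (hε : IsLongitudeSign b φ θ ε) :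
    ∃ e : ℤ, ε = e ∧ (e = 1 ∨ e = -1) := by
  rcases hε.eq_one_or with rfl | rfl
  · exact ⟨1, by simp, Or.inl rfl⟩
  · exact ⟨-1, by simp, Or.inr rfl⟩

theorem cos_sin_snd_add_period (h : IsBipolarGeodesic b φ θ) (hτ : IsHalfPeriod b φ τ)
    (hε : IsLongitudeSign b φ θ ε) (hq : 0 < q) (hΞ : Xi b = p / q * π) (t : ℝ) (n : ℤ) :
    cos (θ (t + n * (2 * q * τ))) = cos (θ t) ∧ sin (θ (t + n * (2 * q * τ))) = sin (θ t) := by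
  rw [h.snd_add_period hτ hε hq hΞ]
  rcases hε.eq_one_or with rfl | rfl
  · rw [one_mul, cos_add_int_mul_two_pi, sin_add_int_mul_two_pi]
    exact ⟨rfl, rfl⟩
  · rw [neg_one_mul, ← sub_eq_add_neg, cos_sub_int_mul_two_pi, sin_sub_int_mul_two_pi]
    exact ⟨rfl, rfl⟩

theorem bipolarImmersion_add_period (h : IsBipolarGeodesic b φ θ) (hτ : IsHalfPeriod b φ τ)
    (hε : IsLongitudeSign b φ θ ε) (hq : 0 < q) (hΞ : Xi b = p / q * π) (α t : ℝ) (m n : ℤ) :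
    bipolarImmersion φ θ (α + m * (2 * π)) (t + n * (2 * q * τ)) = bipolarImmersion φ θ α t := by
  obtain ⟨h1, h2⟩ := h.cos_sin_snd_add_period hτ hε hq hΞ t n
  apply bipolarImmersion_eq φ θ (h.fst_add_period hτ t n) <;>
    simp only [h1, h2, cos_add_int_mul_two_pi, sin_add_int_mul_two_pi]

/-- The exceptional symmetry for even `q`. -/
theorem bipolarImmersion_add_half (h : IsBipolarGeodesic b φ θ) (hτ : IsHalfPeriod b φ τ)
    (hε : IsLongitudeSign b φ θ ε) (hpq : p.Coprime q) (hq : 0 < q) (hΞ : Xi b = p / q * π)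
    (hq2 : Even q) (α t : ℝ) :
    bipolarImmersion φ θ (α + π) (t + 2 * q * τ / 2) = bipolarImmersion φ θ α t := by
  obtain ⟨m, hm⟩ := hq2
  -- With `q = 2m`, half of `2qτ` is `m` latitude periods and turns the longitude by `±pπ`. As `p`
  -- is odd, this changes both signs, as does `α + π`.
  have hp : Odd p := by
    rw [← Nat.not_even_iff_odd]
    intro hp
    have := Nat.dvd_gcd hp.two_dvd (show 2 ∣ q from ⟨m, by omega⟩)
    rw [hpq] at this
    omega
  have ht : t + 2 * q * τ / 2 = t + (m : ℤ) * (2 * τ) := by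
    rw [hm]; push_cast; ring
  have h1 := h.snd_add_int_mul hτ hε t m
  have hm0 : (m : ℝ) ≠ 0 := by
    have : m ≠ 0 := by omega
    exact_mod_cast this
  have h2 : ((m : ℤ) : ℝ) * (2 * (ε * Xi b)) = ε * (p * π) := by
    rw [hΞ, hm]
    push_cast
    field_simp
    ring
  rw [h2] at h1
  rw [ht]
  have h3 : cos (θ t + ε * (p * π)) = -cos (θ t) ∧ sin (θ t + ε * (p * π)) = -sin (θ t) := by
    rcases hε.eq_one_or with rfl | rfl
    · rw [one_mul, cos_add_nat_mul_pi, sin_add_nat_mul_pi, hp.neg_one_pow]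
      simp
    · rw [neg_one_mul, ← sub_eq_add_neg, cos_sub_nat_mul_pi, sin_sub_nat_mul_pi, hp.neg_one_pow]
      simp
  apply bipolarImmersion_eq φ θ (h.fst_add_int_mul hτ t m) <;>
    simp only [h1, h3.1, h3.2, cos_add_pi, sin_add_pi, neg_mul_neg]

/-- A translation of the time by a multiple of the period of the latitude that preserves the
longitude is a multiple of the period of the curve. -/
theorem exists_of_cos_eq_one (hε : IsLongitudeSign b φ θ ε) (hpq : p.Coprime q) (hq : 0 < q)
    (hΞ : Xi b = p / q * π) {j : ℤ}
    (hj : cos (j * (2 * (ε * Xi b))) = 1) : ∃ n : ℤ, j = n * q := by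
  obtain ⟨m, hm⟩ := (cos_eq_one_iff _).1 hj
  have hq' : (q : ℝ) ≠ 0 := by exact_mod_cast hq.ne'
  obtain ⟨e, rfl, he⟩ := hε.exists_int_eq
  rw [hΞ] at hm
  have h1 : (m : ℝ) * q = j * e * p := by
    have hpi := pi_ne_zero
    field_simp at hm
    linarith
  have h2 : m * q = j * e * p := by exact_mod_cast h1
  have hc : IsCoprime (q : ℤ) p := (Nat.isCoprime_iff_coprime.2 hpq).symm
  have h3 : (q : ℤ) ∣ j * e := hc.dvd_of_dvd_mul_right ⟨m, by rw [← h2, mul_comm]⟩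
  obtain ⟨n, hn⟩ : (q : ℤ) ∣ j := by
    rcases he with rfl | rfl
    · simpa using h3
    · simpa using h3
  exact ⟨n, by rw [hn, mul_comm]⟩

/-- A turn by an odd multiple of `π` forces `2j = kq` with `k` odd, so `q` is even. In this form
`2jτ` is half of `2qτ` modulo `2qτ`. -/
theorem exists_of_cos_eq_neg_one (hε : IsLongitudeSign b φ θ ε) (hpq : p.Coprime q) (hq : 0 < q)
    (hΞ : Xi b = p / q * π) {j : ℤ}
    (hj : cos (j * (2 * (ε * Xi b))) = -1) : Even q ∧ ∃ n : ℤ, 2 * j = q + 2 * n * q := by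
  obtain ⟨m, hm⟩ := cos_eq_neg_one_iff.1 hj
  have hq' : (q : ℝ) ≠ 0 := by exact_mod_cast hq.ne'
  obtain ⟨e, rfl, he⟩ := hε.exists_int_eq
  rw [hΞ] at hm
  have h1 : (2 * m + 1 : ℝ) * q = 2 * j * e * p := by
    have hpi := pi_ne_zero
    field_simp at hm
    linarith
  have h2 : (2 * m + 1) * q = 2 * j * e * p := by exact_mod_cast h1
  have hc : IsCoprime (q : ℤ) p := (Nat.isCoprime_iff_coprime.2 hpq).symm
  have h3 : (q : ℤ) ∣ 2 * j * e := hc.dvd_of_dvd_mul_right ⟨2 * m + 1, by rw [← h2, mul_comm]⟩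
  obtain ⟨k, hk⟩ : (q : ℤ) ∣ 2 * j := by
    rcases he with rfl | rfl
    · simpa using h3
    · simpa using h3
  have hq0 : (q : ℤ) ≠ 0 := by exact_mod_cast hq.ne'
  have h4 : 2 * m + 1 = k * e * p := by
    rw [hk] at h2
    apply mul_right_cancel₀ hq0
    linarith
  have hkodd : Odd k := by
    have : Odd (k * e * p) := ⟨m, h4.symm⟩
    exact (Int.odd_mul.1 (Int.odd_mul.1 this).1).1
  obtain ⟨n, rfl⟩ := hkodd
  refine ⟨?_, n, by rw [hk]; ring⟩
  have : Even ((q : ℤ) * (2 * n + 1)) := ⟨j, by rw [← hk]; ring⟩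
  rcases Int.even_mul.1 this with h5 | h5
  · exact_mod_cast h5
  · exact absurd h5 (by simp)

/-- A return to the point at time `0` already determines the period: the minimal latitude recurs
only at `T = 2jτ`, and the longitude then requires `q ∣ j`. -/
theorem isLeast_period (h : IsBipolarGeodesic b φ θ) (hτ : IsHalfPeriod b φ τ)
    (hε : IsLongitudeSign b φ θ ε) (hpq : p.Coprime q) (hq : 0 < q) (hΞ : Xi b = p / q * π) :
    IsLeast {T : ℝ | 0 < T ∧ Function.Periodic (sphereCurve φ θ) T} (2 * q * τ) := by
  have hτ0 := hτ.pos
  have hq' : (0 : ℝ) < q := by exact_mod_cast hq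
  refine ⟨⟨by positivity, fun t => ?_⟩, ?_⟩
  · have h1 := h.cos_sin_snd_add_period hτ hε hq hΞ t 1
    have h2 := h.fst_add_period (q := q) hτ t 1
    rw [Int.cast_one, one_mul] at h1 h2
    simp only [sphereCurve, h1.1, h1.2, h2]
  · rintro T ⟨hT, hper⟩
    have h0 := hper 0
    rw [zero_add] at h0
    have e0 : cos (φ T) * sin (θ T) = cos (φ 0) * sin (θ 0) := congrArg (· 0) h0
    have e1 : cos (φ T) * cos (θ T) = cos (φ 0) * cos (θ 0) := congrArg (· 1) h0
    have e2 : sin (φ T) = sin (φ 0) := congrArg (· 2) h0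
    have hφ : φ T = φ 0 := injOn_sin (Ioo_subset_Icc_self (h.mem_Ioo T))
      (Ioo_subset_Icc_self (h.mem_Ioo 0)) e2
    rw [hφ] at e0 e1
    have hc := (h.cos_pos 0).ne'
    have f0 := mul_left_cancel₀ hc e0
    have f1 := mul_left_cancel₀ hc e1
    obtain ⟨j, hj⟩ : ∃ j : ℤ, T = 0 + j * (2 * τ) := by
      obtain ⟨j, hj | hj⟩ := h.exists_of_fst_eq hτ hφ
      · exact ⟨j, hj⟩
      · exact ⟨j, by rw [hj, neg_zero]⟩
    have h2 := h.snd_add_int_mul hτ hε 0 j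
    rw [← hj] at h2
    have h3 : cos (j * (2 * (ε * Xi b))) = 1 := by
      have : (j : ℝ) * (2 * (ε * Xi b)) = θ T - θ 0 := by linarith
      rw [this, cos_sub, f0, f1]
      linarith [sin_sq_add_cos_sq (θ 0)]
    obtain ⟨n, hn⟩ := exists_of_cos_eq_one hε hpq hq hΞ h3
    have h4 : T = n * (2 * q * τ) := by
      rw [hj, hn]; push_cast; ring
    have h5 : 0 < 2 * q * τ := by positivity
    have h6 : (0 : ℝ) < n := by
      rw [h4] at hT
      exact pos_of_mul_pos_left hT h5.le
    have h7 : (1 : ℝ) ≤ n := by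
      have : 0 < n := by exact_mod_cast h6
      exact_mod_cast this
    rw [h4]
    nlinarith

/-- `ε θ` is strictly increasing and gains `2pπ` in one period; the symmetry of `Z` absorbs the
sign. -/
theorem ncard_snd_mem (h : IsBipolarGeodesic b φ θ) (hτ : IsHalfPeriod b φ τ)
    (hε : IsLongitudeSign b φ θ ε) (hq : 0 < q) (hΞ : Xi b = p / q * π) {Z : Set ℝ}
    (hZ : ∀ x, -x ∈ Z ↔ x ∈ Z) (hcard : ∀ x : ℝ, ∀ n : ℕ, (Z ∩ Ico x (x + n * π)).ncard = n) :
    {t ∈ Ico 0 (2 * q * τ) | θ t ∈ Z}.ncard = 2 * p := by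
  have hτ0 := hτ.pos
  have hZε : ∀ x, ε * x ∈ Z ↔ x ∈ Z := by
    intro x
    rcases hε.eq_one_or with rfl | rfl
    · rw [one_mul]
    · rw [neg_one_mul, hZ]
  have h1 := (h.strictMono_sign_mul hε).ncard_preimage_inter_Ico
    (h.continuous_snd.const_mul ε) (show 0 ≤ 2 * q * τ by positivity) Z
  simp only [hZε] at h1
  have h2 := h.snd_add_period hτ hε hq hΞ 0 1
  have h3 : ε * θ (2 * q * τ) = ε * θ 0 + (2 * p : ℕ) * π := by
    rw [Int.cast_one, one_mul, zero_add] at h2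
    rw [h2]
    have h4 : ε * ε = 1 := by rcases hε.eq_one_or with rfl | rfl <;> norm_num
    push_cast
    linear_combination (p * (2 * π)) * h4
  rw [h1, h3, hcard]

/-- The times at which the curve may meet its image under a time reversal are countably many. -/
theorem exists_countable (h : IsBipolarGeodesic b φ θ) (hτ : IsHalfPeriod b φ τ)
    (hε : IsLongitudeSign b φ θ ε) (hpq : p.Coprime q) (hq : 0 < q) (hΞ : Xi b = p / q * π) :
    ∃ E : Set ℝ, E.Countable ∧ ∀ t ∉ E, ∀ α β s : ℝ,
      bipolarImmersion φ θ β s = bipolarImmersion φ θ α t →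
      cos (β - α) = 1 ∧ (s : AddCircle (2 * q * τ)) = t ∨
      cos (β - α) = -1 ∧ Even q ∧
        (s : AddCircle (2 * q * τ)) = ((t + 2 * q * τ / 2 : ℝ) : AddCircle (2 * q * τ)) := by
  -- If `s = -t + 2jτ`, then `θ s - θ t = 2(θ 0 - θ t + j ε Ξ(b))` must equal some `mπ`; solving for
  -- `θ t` gives this set, countable because `θ` is injective.
  refine ⟨θ ⁻¹' range fun x : ℤ × ℤ => θ 0 + x.1 * (ε * Xi b) - x.2 * π / 2,
    (countable_range _).preimage_of_injOn (h.injective_snd hε).injOn, ?_⟩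
  intro t ht α β s he
  obtain ⟨hφ, hcos⟩ := h.cos_sub_eq_of_bipolarImmersion_eq he
  obtain ⟨j, hj | hj⟩ := h.exists_of_fst_eq hτ hφ
  · have h1 : θ s - θ t = j * (2 * (ε * Xi b)) := by
      rw [hj, h.snd_add_int_mul hτ hε]; ring
    rw [h1] at hcos
    rcases hcos with ⟨h2, h3⟩ | ⟨h2, h3⟩
    · obtain ⟨n, hn⟩ := exists_of_cos_eq_one hε hpq hq hΞ h3
      refine Or.inl ⟨h2, AddCircle.coe_eq_coe_iff_exists.2 ⟨n, ?_⟩⟩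
      rw [hj, hn]; push_cast; ring
    · obtain ⟨hq2, n, hn⟩ := exists_of_cos_eq_neg_one hε hpq hq hΞ h3
      refine Or.inr ⟨h2, hq2, AddCircle.coe_eq_coe_iff_exists.2 ⟨n, ?_⟩⟩
      have hn' : (2 * j : ℝ) = q + 2 * n * q := by exact_mod_cast hn
      rw [hj]
      linear_combination τ * hn'
  · exfalso
    have h1 : θ s - θ t = 2 * (θ 0 - θ t + j * (ε * Xi b)) := by
      rw [hj, h.snd_add_int_mul hτ hε, h.snd_neg hτ hε]; ring
    have h2 : sin (θ s - θ t) = 0 := by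
      rw [sin_eq_zero_iff_cos_eq]
      exact hcos.imp And.right And.right
    obtain ⟨m, hm⟩ := sin_eq_zero_iff.1 h2
    refine ht ⟨(j, m), ?_⟩
    simp only
    rw [hm, h1]
    ring

end IsBipolarGeodesic

/-! ### Rigidity of the immersion of the torus. -/

/-- The invariances of the immersion of the torus. -/
theorem IsBipolarGeodesic.eq_id_or_of_comp_eq {b τ ε : ℝ} {φ θ : ℝ → ℝ} {p q : ℕ}
    (h : IsBipolarGeodesic b φ θ) (hτ : IsHalfPeriod b φ τ)
    (hε : IsLongitudeSign b φ θ ε) (hpq : p.Coprime q) (hq : 0 < q) (hΞ : Xi b = p / q * π)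
    {J : AddCircle (2 * π) × AddCircle (2 * q * τ) → EuclideanSpace ℝ (Fin 5)}
    (hJ : ∀ α t : ℝ, J ((α : AddCircle (2 * π)), (t : AddCircle (2 * q * τ))) =
      bipolarImmersion φ θ α t)
    {F : AddCircle (2 * π) × AddCircle (2 * q * τ) → AddCircle (2 * π) × AddCircle (2 * q * τ)}
    (hF : Continuous F) (hJF : J ∘ F = J) :
    F = id ∨ (Even q ∧ ∀ α t : ℝ, F ((α : AddCircle (2 * π)), (t : AddCircle (2 * q * τ))) =
      (((α + π : ℝ) : AddCircle (2 * π)),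
        ((t + 2 * q * τ / 2 : ℝ) : AddCircle (2 * q * τ)))) := by
  obtain ⟨E, hE, hEs⟩ := h.exists_countable hτ hε hpq hq hΞ
  have hEd : Dense Eᶜ := hE.dense_compl ℝ
  have hlift : ∀ α t : ℝ, ∃ β s : ℝ,
      F ((α : AddCircle (2 * π)), (t : AddCircle (2 * q * τ))) =
        ((β : AddCircle (2 * π)), (s : AddCircle (2 * q * τ))) ∧
        bipolarImmersion φ θ β s = bipolarImmersion φ θ α t := by
    intro α t
    obtain ⟨β, hβ⟩ := QuotientAddGroup.mk_surjective
      (F ((α : AddCircle (2 * π)), (t : AddCircle (2 * q * τ)))).1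
    obtain ⟨s, hs⟩ := QuotientAddGroup.mk_surjective
      (F ((α : AddCircle (2 * π)), (t : AddCircle (2 * q * τ)))).2
    have h1 : F ((α : AddCircle (2 * π)), (t : AddCircle (2 * q * τ))) =
        ((β : AddCircle (2 * π)), (s : AddCircle (2 * q * τ))) :=
      Prod.ext hβ.symm hs.symm
    refine ⟨β, s, h1, ?_⟩
    rw [← hJ, ← hJ, ← h1]
    exact congrFun hJF _
  -- the cosine of the rotation angle is constant
  let G : AddCircle (2 * π) × AddCircle (2 * q * τ) → ℝ := fun x =>
    Real.Angle.cos (show Real.Angle from (F x).1 - x.1)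
  have hGc : Continuous G :=
    Real.Angle.continuous_cos.comp ((_root_.continuous_fst.comp hF).sub _root_.continuous_fst)
  have hG : ∀ α t β s : ℝ, F ((α : AddCircle (2 * π)), (t : AddCircle (2 * q * τ))) =
        ((β : AddCircle (2 * π)), (s : AddCircle (2 * q * τ))) →
      G ((α : AddCircle (2 * π)), (t : AddCircle (2 * q * τ))) = cos (β - α) := by
    intro α t β s hF
    simp only [G, hF]
    exact Real.Angle.cos_coe (β - α)
  have hG1 : ∀ x, G x = 1 ∨ G x = -1 := by
    rintro ⟨x, y⟩
    obtain ⟨α, rfl⟩ := QuotientAddGroup.mk_surjective x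
    obtain ⟨t, rfl⟩ := QuotientAddGroup.mk_surjective y
    obtain ⟨β, s, h1, h2⟩ := hlift α t
    have h3 := hG α t β s h1
    rw [show G (QuotientAddGroup.mk α, QuotientAddGroup.mk t) = cos (β - α) from h3]
    exact (h.cos_sub_eq_of_bipolarImmersion_eq h2).2.imp And.left And.left
  -- A continuous function on the connected torus with values `±1` is constant.
  have hGconst : (∀ x, G x = 1) ∨ ∀ x, G x = -1 := by
    by_contra! hcon
    obtain ⟨⟨x, hx⟩, ⟨y, hy⟩⟩ := hcon
    have hx' := (hG1 x).resolve_left hx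
    have hy' := (hG1 y).resolve_right hy
    obtain ⟨z, hz⟩ := mem_range_of_exists_le_of_exists_ge hGc (c := (0 : ℝ))
      ⟨x, by rw [hx']; norm_num⟩ ⟨y, by rw [hy']; norm_num⟩
    rcases hG1 z with h1 | h1 <;> rw [hz] at h1 <;> norm_num at h1
  have hpc : Continuous fun x : ℝ × ℝ =>
      ((x.1 : AddCircle (2 * π)), (x.2 : AddCircle (2 * q * τ))) := by
    have h1 : Continuous ((↑) : ℝ → AddCircle (2 * π)) := continuous_quotient_mk'
    have h2 : Continuous ((↑) : ℝ → AddCircle (2 * q * τ)) := continuous_quotient_mk'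
    exact (h1.comp _root_.continuous_fst).prodMk (h2.comp _root_.continuous_snd)
  -- For times outside `E` the value of `F` is forced by the constant value of `G`; continuity
  -- extends the formula to all times.
  have hDd : Dense ((univ : Set ℝ) ×ˢ Eᶜ) := dense_univ.prod hEd
  rcases hGconst with h1 | h1
  · left
    have key : (fun x : ℝ × ℝ => F ((x.1 : AddCircle (2 * π)), (x.2 : AddCircle (2 * q * τ)))) =
        fun x : ℝ × ℝ => ((x.1 : AddCircle (2 * π)), (x.2 : AddCircle (2 * q * τ))) := by
      refine Continuous.ext_on hDd (hF.comp hpc) hpc ?_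
      rintro ⟨α, t⟩ ⟨-, ht⟩
      obtain ⟨β, s, h2, h3⟩ := hlift α t
      have h4 := h1 ((α : AddCircle (2 * π)), (t : AddCircle (2 * q * τ)))
      rw [hG α t β s h2] at h4
      simp only [h2]
      rcases hEs t ht α β s h3 with ⟨-, h5⟩ | ⟨h5, -⟩
      · rw [h5]
        obtain ⟨n, hn⟩ := (cos_eq_one_iff _).1 h4
        rw [AddCircle.coe_eq_coe_iff_exists.2 (show ∃ n : ℤ, β = α + n * (2 * π) from
          ⟨n, by linarith⟩)]
      · rw [h4] at h5
        norm_num at h5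
    funext ⟨x, y⟩
    obtain ⟨α, rfl⟩ := QuotientAddGroup.mk_surjective x
    obtain ⟨t, rfl⟩ := QuotientAddGroup.mk_surjective y
    exact congrFun key (α, t)
  · right
    have hstep : ∀ α : ℝ, ∀ t ∉ E, Even q ∧
        F ((α : AddCircle (2 * π)), (t : AddCircle (2 * q * τ))) =
          (((α + π : ℝ) : AddCircle (2 * π)),
            ((t + 2 * q * τ / 2 : ℝ) : AddCircle (2 * q * τ))) := by
      intro α t ht
      obtain ⟨β, s, h2, h3⟩ := hlift α t
      have h4 := h1 ((α : AddCircle (2 * π)), (t : AddCircle (2 * q * τ)))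
      rw [hG α t β s h2] at h4
      rcases hEs t ht α β s h3 with ⟨h5, -⟩ | ⟨-, hq2, h5⟩
      · rw [h4] at h5
        norm_num at h5
      · refine ⟨hq2, ?_⟩
        rw [h2, h5]
        obtain ⟨n, hn⟩ := cos_eq_neg_one_iff.1 h4
        rw [AddCircle.coe_eq_coe_iff_exists.2 (show ∃ n : ℤ, β = α + π + n * (2 * π) from
          ⟨n, by linarith⟩)]
    obtain ⟨t₁, ht₁⟩ := hEd.nonempty
    refine ⟨(hstep 0 t₁ ht₁).1, fun α t => ?_⟩
    have key : (fun x : ℝ × ℝ => F ((x.1 : AddCircle (2 * π)), (x.2 : AddCircle (2 * q * τ)))) =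
        fun x : ℝ × ℝ => (((x.1 + π : ℝ) : AddCircle (2 * π)),
            ((x.2 + 2 * q * τ / 2 : ℝ) : AddCircle (2 * q * τ))) := by
      refine Continuous.ext_on hDd (hF.comp hpc) (hpc.comp (g := fun x : ((ℝ × ℝ)) => _)
        (f := fun x : ℝ × ℝ => (x.1 + π, x.2 + 2 * q * τ / 2)) (by fun_prop)) ?_
      rintro ⟨α, t⟩ ⟨-, ht⟩
      exact (hstep α t ht).2
    exact congrFun key (α, t)

theorem proposition4 (p q : ℕ) (hpq : p.Coprime q)
    (hlow : (1 / 2 : ℝ) < (p : ℝ) / (q : ℝ)) (hupp : (p : ℝ) / (q : ℝ) < √2 / 2)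
    -- the Otsuki torus with parameter `p / q` and a unit normal field of it
    (a : ℝ) (ha : a ∈ Ioo 0 (π / 4)) (hΩ : Omega a = (p : ℝ) / (q : ℝ) * π)
    (ν lam : ℝ → ℝ) (hν : IsOtsukiGeodesic a ν lam)
    (N : ℝ → ℝ → EuclideanSpace ℝ (Fin 4))
    (hN : IsUnitNormalField (otsukiImmersion ν lam) N)
    -- the parametrization of its bipolar surface by means of a geodesic `(φ, θ)`
    (b : ℝ) (φ θ : ℝ → ℝ) (hφ : IsBipolarGeodesic b φ θ)
    (hJ : range (fun x : ℝ × ℝ => equatorInclusion (bipolarImmersion φ θ x.1 x.2)) =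
      bipolarSurface (otsukiImmersion ν lam) N) :
    Omega a = Xi b ∧
    -- the geodesic is closed, of length `t₀`
    ∃ t₀ : ℝ, IsLeast {T : ℝ | 0 < T ∧ Function.Periodic (sphereCurve φ θ) T} t₀ ∧
      {t ∈ Ico 0 t₀ | sin (φ t) = 0}.ncard = 2 * q ∧
      {t ∈ Ico 0 t₀ | cos (θ t) = 0}.ncard = 2 * p ∧
      {t ∈ Ico 0 t₀ | sin (θ t) = 0}.ncard = 2 * p ∧
      (Even q → ∀ α t : ℝ,
        bipolarImmersion φ θ (α + π) (t + t₀ / 2) = bipolarImmersion φ θ α t) ∧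
      -- the immersion of the torus, and the absence of other invariances
      ∃ J : AddCircle (2 * π) × AddCircle t₀ → EuclideanSpace ℝ (Fin 5),
        (∀ α t : ℝ, J ((α : AddCircle (2 * π)), (t : AddCircle t₀)) =
          bipolarImmersion φ θ α t) ∧
        ∀ F : AddCircle (2 * π) × AddCircle t₀ → AddCircle (2 * π) × AddCircle t₀,
          Continuous F → J ∘ F = J →
            F = id ∨
            (Even q ∧ ∀ α t : ℝ, F ((α : AddCircle (2 * π)), (t : AddCircle t₀)) =
              (((α + π : ℝ) : AddCircle (2 * π)), ((t + t₀ / 2 : ℝ) : AddCircle t₀))) := by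
  have hq : 0 < q := by
    rcases Nat.eq_zero_or_pos q with rfl | hq
    · norm_num at hlow
    · exact hq
  have hab := cos_sq_eq_of_range_eq_bipolarSurface ha hν hN hφ hJ
  -- `cos² b = sin 2a < 1` excludes the equator.
  have hb : b < 0 := by
    refine lt_of_le_of_ne hφ.b_nonpos ?_
    rintro rfl
    rw [cos_zero, one_pow, ← mul_assoc, ← sin_two_mul] at hab
    have := sin_lt_sin_of_lt_of_le_pi_div_two (x := 2 * a) (y := π / 2)
      (by linarith [ha.1, pi_pos]) le_rfl (by linarith [ha.2])
    rw [sin_pi_div_two] at this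
    linarith
  have hΩΞ := hφ.Omega_eq_Xi hb ha hab
  refine ⟨hΩΞ, ?_⟩
  have hΞ : Xi b = p / q * π := hΩΞ ▸ hΩ
  obtain ⟨τ, hτ⟩ := hφ.exists_isHalfPeriod hb
  obtain ⟨ε, hε1, hε2⟩ := hφ.exists_hasDerivAt_snd
  have hε : IsBipolarGeodesic.IsLongitudeSign b φ θ ε := ⟨hε1, hε2⟩
  refine ⟨2 * q * τ, hφ.isLeast_period hτ hε hpq hq hΞ, ?_, ?_, ?_,
    hφ.bipolarImmersion_add_half hτ hε hpq hq hΞ, ?_⟩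
  · have := hφ.ncard_sin_fst_eq_zero hb hτ (2 * q)
    push_cast at this
    exact this
  · exact hφ.ncard_snd_mem (Z := {x | cos x = 0}) hτ hε hq hΞ
      (fun x => by simp) ncard_cos_eq_zero_Ico
  · exact hφ.ncard_snd_mem (Z := {x | sin x = 0}) hτ hε hq hΞ
      (fun x => by simp) ncard_sin_eq_zero_Ico
  -- The map on the torus is defined through chosen representatives; periodicity makes the choice
  -- irrelevant.
  · have hJlift : ∀ α t : ℝ, bipolarImmersion φ θ (Quotient.out (α : AddCircle (2 * π)))
        (Quotient.out (t : AddCircle (2 * q * τ))) = bipolarImmersion φ θ α t := by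
      intro α t
      obtain ⟨m, hm⟩ := AddCircle.coe_eq_coe_iff_exists.1
        (QuotientAddGroup.out_eq' (α : AddCircle (2 * π)))
      obtain ⟨n, hn⟩ := AddCircle.coe_eq_coe_iff_exists.1
        (QuotientAddGroup.out_eq' (t : AddCircle (2 * q * τ)))
      rw [hm, hn, hφ.bipolarImmersion_add_period hτ hε hq hΞ]
    exact ⟨fun x => bipolarImmersion φ θ (Quotient.out x.1) (Quotient.out x.2), hJlift,
      fun F hF hJF => hφ.eq_id_or_of_comp_eq hτ hε hpq hq hΞ hJlift hF hJF⟩
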